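/- Let $A\in\mathbb R^{m\times n}$, $b\in\mathbb R^m$, $c\in\mathbb R^n$ and consider $$\text{(MP)}\qquad \min\{c^Tx \mid Ax=b,\ x\in\{0,1\}^n\}.$$ Let $M\ge 0$ satisfy $c^Tx<M$ for every feasible $x$ of (MP). **Subproblems.** A subproblem fixes some of the variables to values in $\{0,1\}$; in the remaining (free) variables it reads $\min\{\hat c^T\hat x+\hat C_{\rm obj}\mid \hat A\hat x=\hat b,\ \hat x \text{ binary}\}$, where $\hat A,\hat c$ are the restrictions of $A,c$ to the free variables, $\hat b=b-\sum_{k\text{ fixed}}A_{\cdot k}x_k$ and $\hat C_{\rm obj}=\sum_{k\text{ fixed}}c_kx_k$. Let $(\kappa,\tau)$ be either $(\tfrac14,0)$ or $(\tfrac12,\tfrac14)$ (one choice for the whole search). The Ising Hamiltonian of the subproblem is $\hat H(\sigma)=-\sum_{i<j}\hat J_{ij}\sigma_i\sigma_j-\mu\sum_i\hat h_i\sigma_i$ with $\mu=-\tfrac12$, $\hat J=-\kappa M\hat A^T\hat A$, $\hat h=\hat c^T-2M\hat b^T\hat A+M\mathbf 1^T\hat A^T\hat A$, and the constant put aside is $\hat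 C=\tfrac14M\mathbf 1^T\hat A^T\hat A\mathbf 1+\tfrac12\mathbf 1^T\hat c-M\hat b^T\hat A\mathbf 1+M\hat b^T\hat b+\tau M\operatorname{tr}(\hat A^T\hat A)+\hat C_{\rm obj}$. **Bounds.** Let $G$ be the weighted graph on the free variables and one additional vertex $0$ whose weights are the coefficients of $\hat H$: $w_{ij}=-\hat J_{ij}$ for $i<j$ and $w_{0i}=-\mu\hat h_i$. Let $W$ and $W^-$ be the sum of all and of all negative weights, $\alpha=0.87856$, and $z_{GW}$ the expected value of the cut returned by the Goemans–Williamson algorithm on $G$ (an optimal solution of the semidefinite relaxation, rounded by a random hyperplane with Gaussian normal vector). Put $LB_{GW}(\hat H)=-\frac2\alpha z_{GW}+(\frac2\alpha-2)W^-+W$. The lower bound of the root (no variable fixed) is $\ell=LB_{GW}(H)+C$; the lower bound of a child with Hamiltonian $\tilde H$, constant $\tilde C$ and parent bound $\hat\ell$ is $\tilde\ell=\max\{LB_{GW}(\tilde H)+\tilde C,\ \hat\ell\}$. **Search.** Initially only the root is open and there is no incumbent. In each step an open node of lowest lower bound is processed and removed from the open nodes: (a) if some single constraint cannot be satisfied by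 any values of the free variables, or $LB_{GW}(\hat H)+\hat C\ge M$, the node is discarded as infeasible; (b) otherwise, if it has no free variable, its only assignment replaces the incumbent if it is feasible and better; (c) otherwise a finite multiset of assignments of the free variables is sampled (by a quantum device, about which nothing is assumed); a best feasible sample replaces the incumbent if it is better; if the lower bound of the node then exceeds the incumbent value, the node is pruned; if not, a free variable $k$ of maximal conflict value is chosen, and the two children for $x_k=0$ and $x_k=1$ become open. In each child, any number of further free variables may have been fixed by propagation, i.e. to the only value that some single constraint leaves for them, given the values fixed before. The conflict value of variable $i$ is the sum, over the constraints in which it has a nonzero coefficient, of the fraction of samples violating the constraint. The search may stop as soon as no open node has a lower bound below the incumbent value (which is $+\infty$ if there is no incumbent), in particular if no node is open. The global lower bound is the minimum of the incumbent value and the lower bounds of the open nodes. For all samples, all optimal solutions of the semidefinite relaxations, and all choices left open above, the following holds. 1. Lower bounds are monotone along tree paths: $\hat\ell\le\tilde\ell$ whenever $\tilde H$ belongs to a descendant of the node of $\hat H$. Moreover, the lower bound of a node is at most $c^Tx$ for every feasible $x$ of (MP) that agrees with its fixed variables. 2. At a node without free variables, with assignment $x$, either a constraint is violated, so that the subproblem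 is proven infeasible, or $x$ is feasible and the lower bound of the node equals $c^Tx$, its upper bound. 3. The search can be started, does not get stuck before the stopping criterion holds, and has no infinite execution. At any time at most $2^n-1$ nodes with a free variable have been processed (and at most $2^{n+1}-1$ nodes if those without free variables, which need no bounding or branching, are counted too). During the search the global lower bound never decreases, the incumbent value never increases, the optimal value of (MP) ($+\infty$ if infeasible) lies between them, and every feasible $x$ that is better than the incumbent agrees with the fixed variables of some open node. When the stopping criterion holds, both bounds equal the optimal value, and either there is no incumbent and (MP) is infeasible, or the incumbent is a globally optimal solution of (MP). -/

import Mathlib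

open MeasureTheory ProbabilityTheory
open scoped Matrix

namespace QCBB

noncomputable section

/-! ### Binary linear programs -/

/-- The binary linear program `min {cᵀx + offset | Ax = b, x ∈ {0,1}^ι}`. The offset collects the
objective contribution of variables that have already been eliminated. -/
structure BLP (m : ℕ) (ι : Type) where
  A : Matrix (Fin m) ι ℝ
  b : Fin m → ℝ
  c : ι → ℝ
  offset : ℝ

/-- The real number `0` or `1` encoded by a Boolean. -/
def bit (v : Bool) : ℝ := if v then 1 else 0

/-- The master problem `min {cᵀx | Ax = b, x ∈ {0,1}^n}`. -/
def master {m n : ℕ} (A : Matrix (Fin m) (Fin n) ℝ) (b : Fin m → ℝ) (c : Fin n → ℝ) :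
    BLP m (Fin n) := ⟨A, b, c, 0⟩

section BLP

variable {m : ℕ} {ι : Type} [Fintype ι]

def BLP.obj (P : BLP m ι) (x : ι → Bool) : ℝ := ∑ i, P.c i * bit (x i) + P.offset

/-- The `j`-th equality constraint holds at `x`. -/
def BLP.RowHolds (P : BLP m ι) (j : Fin m) (x : ι → Bool) : Prop :=
  ∑ i, P.A j i * bit (x i) = P.b j

def BLP.Feasible (P : BLP m ι) (x : ι → Bool) : Prop := ∀ j, P.RowHolds j x

/-- The optimal value, `⊤` if there is no feasible point. -/
def BLP.optValue (P : BLP m ι) : EReal := ⨅ x : {x : ι → Bool // P.Feasible x}, (P.obj x : EReal)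

def BLP.IsOptimal (P : BLP m ι) (x : ι → Bool) : Prop :=
  P.Feasible x ∧ ∀ y, P.Feasible y → P.obj x ≤ P.obj y

/-! ### The Ising Hamiltonian `- ∑_{i<j} J i j σ i σ j - μ ∑ h i σ i`, with `μ = -1/2` -/

/-- Two normalizations of the Ising form of `cᵀx + M‖Ax - b‖²` under `x = (σ + 1)/2`.
`quarter`: `J = -(1/4) M AᵀA`, and the diagonal of `AᵀA` enters the constant term only through
`1ᵀAᵀA1`; the sum of the Hamiltonian and the constant is then at most `cᵀx + M‖Ax - b‖²` for `M ≥ 0`.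
`half`: each pair `i < j` carries both symmetric entries, `J = -(1/2) M AᵀA`, and the diagonal
`(1/4) M tr(AᵀA)` is added to the constant; the sum is then equal to `cᵀx + M‖Ax - b‖²`. -/
inductive IsingForm
  | quarter
  | half

def IsingForm.couplingCoeff : IsingForm → ℝ
  | .quarter => 1 / 4
  | .half => 1 / 2

def IsingForm.diagCoeff : IsingForm → ℝ
  | .quarter => 0
  | .half => 1 / 4

def BLP.gram (P : BLP m ι) : Matrix ι ι ℝ := P.Aᵀ * P.A

def BLP.J (P : BLP m ι) (f : IsingForm) (M : ℝ) : Matrix ι ι ℝ := (-(f.couplingCoeff * M)) • P.gram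

/-- `h = cᵀ - 2M bᵀA + M 1ᵀ(AᵀA)`. -/
def BLP.h (P : BLP m ι) (M : ℝ) (i : ι) : ℝ :=
  P.c i - 2 * M * ∑ j, P.b j * P.A j i + M * ∑ k, P.gram k i

def mu : ℝ := -(1 / 2)

/-- `(1/4) M 1ᵀ(AᵀA)1 + (1/2) 1ᵀc - M bᵀA1 + M bᵀb`, with the diagonal correction of the chosen
normalization. -/
def BLP.transformConst (P : BLP m ι) (f : IsingForm) (M : ℝ) : ℝ :=
  1 / 4 * M * (∑ i, ∑ k, P.gram i k) + 1 / 2 * (∑ i, P.c i)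
    - M * (∑ j, ∑ i, P.b j * P.A j i) + M * (∑ j, P.b j * P.b j)
    + f.diagCoeff * M * P.gram.trace

/-- The whole constant put aside by the Hamiltonian, including the value of eliminated variables. -/
def BLP.const (P : BLP m ι) (f : IsingForm) (M : ℝ) : ℝ := P.transformConst f M + P.offset

/-- The Maximum Cut instance of the Hamiltonian. The vertices are the variables and one additional
vertex `none`, whose spin is `1`. The weights are the coefficients of the Hamiltonian, that is `-J`
and `-μ h`, so that its value at a spin configuration is the total weight minus twice the weight of
the corresponding cut. Every undirected edge is stored once, as an ordered pair; all other pairs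
have weight zero. -/
def BLP.cutWeight [LinearOrder ι] (P : BLP m ι) (f : IsingForm) (M : ℝ) :
    Option ι → Option ι → ℝ
  | none, some i => -(mu * P.h M i)
  | some i, some j => if i < j then -P.J f M i j else 0
  | _, none => 0

end BLP

/-! ### Maximum Cut and the Goemans–Williamson value -/

section MaxCut

variable {V : Type} [Fintype V]

open Classical in
/-- Total weight of the edges between `S` and its complement. -/
def cutValue (w : V → V → ℝ) (S : Set V) : ℝ :=
  ∑ u, ∑ v, if (u ∈ S ↔ v ∈ S) then 0 else w u v

/-- Objective of the semidefinite relaxation at the vectors `y`. -/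
def sdpValue (w : V → V → ℝ) (y : V → EuclideanSpace ℝ V) : ℝ :=
  ∑ u, ∑ v, w u v * ((1 - inner ℝ (y u) (y v)) / 2)

/-- `y` is an optimal solution of the semidefinite relaxation: unit vectors, one for each vertex,
which maximize the relaxed cut value. -/
def IsSDPOptimal (w : V → V → ℝ) (y : V → EuclideanSpace ℝ V) : Prop :=
  (∀ u, ‖y u‖ = 1) ∧
    ∀ y' : V → EuclideanSpace ℝ V, (∀ u, ‖y' u‖ = 1) → sdpValue w y' ≤ sdpValue w y

/-- One side of the cut of the hyperplane with normal vector `r`. -/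
def hyperplaneSide (y : V → EuclideanSpace ℝ V) (r : EuclideanSpace ℝ V) : Set V :=
  {u | 0 ≤ inner ℝ (y u) r}

/-- `z` is the expected value of the cut returned by the Goemans–Williamson algorithm: an optimal
solution of the semidefinite relaxation is rounded by a hyperplane whose normal vector has the
standard Gaussian distribution, so that its direction is uniform. -/
def IsGWValue (w : V → V → ℝ) (z : ℝ) : Prop :=
  ∃ y, IsSDPOptimal w y ∧
    z = ∫ r, cutValue w (hyperplaneSide y r) ∂(stdGaussian (EuclideanSpace ℝ V))

def totalWeight (w : V → V → ℝ) : ℝ := ∑ u, ∑ v, w u v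

open Classical in
def negWeight (w : V → V → ℝ) : ℝ := ∑ u, ∑ v, if w u v < 0 then w u v else 0

def alphaGW : ℝ := 0.87856

/-- The lower bound on the ground state energy that is computed from the cut value `z`. -/
def lbGW (w : V → V → ℝ) (z : ℝ) : ℝ :=
  -(2 / alphaGW) * z + (2 / alphaGW - 2) * negWeight w + totalWeight w

end MaxCut

/-! ### Conflict values -/

section Conflict

variable {m : ℕ} {ι : Type} [Fintype ι]

open Classical in
/-- The fraction of the samples that violate constraint `j`. -/
def BLP.violationScore (P : BLP m ι) (X : Multiset (ι → Bool)) (j : Fin m) : ℝ :=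
  (X.countP (fun x => ¬ P.RowHolds j x) : ℝ) / (X.card : ℝ)

open Classical in
/-- The conflict value of variable `i`: the sum of the scores of the constraints containing `i`. -/
def BLP.conflict (P : BLP m ι) (X : Multiset (ι → Bool)) (i : ι) : ℝ :=
  ∑ j, P.violationScore X j * (if P.A j i ≠ 0 then 1 else 0)

end Conflict

/-! ### Nodes of the search tree -/

/-- A set of fixed variables with their values; `none` marks a free variable. -/
abbrev Partial (n : ℕ) := Fin n → Option Bool

abbrev Free {n : ℕ} (p : Partial n) := {i : Fin n // p i = none}

def Extends {n : ℕ} (x : Fin n → Bool) (p : Partial n) : Prop := ∀ i v, p i = some v → x i = v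

/-- The full assignment made of the fixed values in `p` and the values `y` of the free variables. -/
def complete {n : ℕ} (p : Partial n) (y : Free p → Bool) (i : Fin n) : Bool :=
  if h : p i = none then y ⟨i, h⟩ else (p i).getD false

/-- The contribution of variable `i` to a sum over fixed variables with coefficients `a`. -/
def fixedTerm (a : ℝ) : Option Bool → ℝ
  | none => 0
  | some v => a * bit v

/-- The reduced problem in the free variables: columns of fixed variables are removed, the right
hand side and the constant of the objective are adjusted to the fixed values. -/
def BLP.reduce {m n : ℕ} (P : BLP m (Fin n)) (p : Partial n) : BLP m (Free p) where
  A := P.A.submatrix id Subtype.val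
  b := fun j => P.b j - ∑ k, fixedTerm (P.A j k) (p k)
  c := fun i => P.c i
  offset := P.offset + ∑ k, fixedTerm (P.c k) (p k)

/-- A node carries its fixed variables, the bound `gw` computed from its own Hamiltonian, and its
lower bound `lb`; both include the constant term. -/
structure Node (n : ℕ) where
  fixed : Partial n
  gw : ℝ
  lb : ℝ

def Node.HasFree {n : ℕ} (N : Node n) : Prop := ∃ i, N.fixed i = none

instance {n : ℕ} : DecidablePred (Node.HasFree (n := n)) := fun N =>
  inferInstanceAs (Decidable (∃ i, N.fixed i = none))

section Algorithm

variable {m n : ℕ} (P : BLP m (Fin n)) (f : IsingForm) (M : ℝ)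

/-- `g` is the Goemans–Williamson bound plus the constant term of the subproblem at `p`. -/
def IsLocalBound (p : Partial n) (g : ℝ) : Prop :=
  ∃ z, IsGWValue ((P.reduce p).cutWeight f M) z ∧
    g = lbGW ((P.reduce p).cutWeight f M) z + (P.reduce p).const f M

/-- The root: the master problem, no variable is fixed. -/
def IsRoot (N : Node n) : Prop :=
  N.fixed = (fun _ => none) ∧ IsLocalBound P f M N.fixed N.gw ∧ N.lb = N.gw

/-- One step of bound propagation: a single constraint, given the fixed values, leaves only the
value `v` for the free variable `i`, which is then fixed. -/
def PropagateStep (p p' : Partial n) : Prop :=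
  ∃ (j : Fin m) (i : Fin n) (v : Bool), p i = none ∧
    (∀ x, Extends x p → P.RowHolds j x → x i = v) ∧ p' = Function.update p i (some v)

/-- Any number of propagation steps. -/
def Propagates : Partial n → Partial n → Prop := Relation.ReflTransGen (PropagateStep P)

/-- `N'` is a child of `N` for `x k = v`: the variable is fixed, bounds are propagated, the bound
of the reduced problem is computed and replaced by the one of the parent if that is larger. -/
def IsChild (N : Node n) (k : Fin n) (v : Bool) (N' : Node n) : Prop :=
  N.fixed k = none ∧ Propagates P (Function.update N.fixed k (some v)) N'.fixed ∧
    IsLocalBound P f M N'.fixed N'.gw ∧ N'.lb = max N'.gw N.lb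

/-- A tree edge. -/
def ChildRel (N N' : Node n) : Prop := ∃ k v, IsChild P f M N k v N'

/-- The nodes that can be reached from a root by a path of tree edges. -/
def IsTreeNode (N : Node n) : Prop :=
  ∃ R, IsRoot P f M R ∧ Relation.ReflTransGen (ChildRel P f M) R N

/-- Some constraint alone cannot be satisfied any more. -/
def Contradiction (p : Partial n) : Prop := ∃ j, ∀ x, Extends x p → ¬ P.RowHolds j x

/-- The two infeasibility tests: a contradictory constraint, or a bound that reaches `M`. -/
def ProvenInfeasible (N : Node n) : Prop := Contradiction P N.fixed ∨ M ≤ N.gw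

/-! ### The search -/

/-- Open nodes, best feasible solution found so far, and nodes processed so far. -/
structure State (n : ℕ) where
  frontier : Multiset (Node n)
  incumbent : Option (Fin n → Bool)
  processed : List (Node n)

/-- The upper bound given by an incumbent, `⊤` if there is none. -/
def upperBound (inc : Option (Fin n → Bool)) : EReal :=
  match inc with
  | none => ⊤
  | some x => (P.obj x : EReal)

/-- The lowest bound among the open nodes and the incumbent. -/
def globalLB (s : State n) : EReal :=
  min (upperBound P s.incumbent) (⨅ N ∈ s.frontier, (N.lb : EReal))

/-- A best feasible sample becomes the incumbent if it improves on the previous one; otherwise the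
incumbent is kept. -/
def IncumbentUpdate (inc : Option (Fin n → Bool)) (X : Multiset (Fin n → Bool))
    (inc' : Option (Fin n → Bool)) : Prop :=
  (inc' = inc ∧ ∀ x ∈ X, P.Feasible x → upperBound P inc ≤ (P.obj x : EReal)) ∨
  ∃ x ∈ X, P.Feasible x ∧ (P.obj x : EReal) < upperBound P inc ∧
    (∀ y ∈ X, P.Feasible y → P.obj x ≤ P.obj y) ∧ inc' = some x

/-- The samples obtained from the quantum device: `X t p` is the multiset of measured assignments of
the free variables of the subproblem `p` if that is processed after `t` other ones. -/
abbrev Samples (n : ℕ) := ℕ → (p : Partial n) → Multiset (Free p → Bool)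

/-- Processing one open node `N` of lowest lower bound, `F` being the other open nodes.
* `infeasible`: `N` passes an infeasibility test and is discarded.
* `leaf`: no free variable is left, the only assignment `x` of the subproblem is a candidate.
* `prune`: after the samples of the quantum device have updated the incumbent, the bound of `N`
  exceeds the incumbent value.
* `branch`: otherwise, both children for a variable of maximal conflict value become open. -/
inductive Step (X : Samples n) : State n → State n → Prop
  | infeasible (N : Node n) (F : Multiset (Node n)) (inc : Option (Fin n → Bool))
      (done : List (Node n)) (hsel : ∀ N' ∈ F, N.lb ≤ N'.lb) (hinf : ProvenInfeasible P M N) :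
      Step X ⟨N ::ₘ F, inc, done⟩ ⟨F, inc, N :: done⟩
  | leaf (N : Node n) (F : Multiset (Node n)) (inc inc' : Option (Fin n → Bool))
      (done : List (Node n)) (x : Fin n → Bool) (hsel : ∀ N' ∈ F, N.lb ≤ N'.lb)
      (hinf : ¬ ProvenInfeasible P M N) (hleaf : ¬ N.HasFree) (hx : Extends x N.fixed)
      (hupd : IncumbentUpdate P inc {x} inc') :
      Step X ⟨N ::ₘ F, inc, done⟩ ⟨F, inc', N :: done⟩
  | prune (N : Node n) (F : Multiset (Node n)) (inc inc' : Option (Fin n → Bool))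
      (done : List (Node n)) (hsel : ∀ N' ∈ F, N.lb ≤ N'.lb)
      (hinf : ¬ ProvenInfeasible P M N) (hfree : N.HasFree)
      (hupd : IncumbentUpdate P inc ((X done.length N.fixed).map (complete N.fixed)) inc')
      (hprune : upperBound P inc' < (N.lb : EReal)) :
      Step X ⟨N ::ₘ F, inc, done⟩ ⟨F, inc', N :: done⟩
  | branch (N N₀ N₁ : Node n) (F : Multiset (Node n)) (inc inc' : Option (Fin n → Bool))
      (done : List (Node n)) (k : Free N.fixed)
      (hsel : ∀ N' ∈ F, N.lb ≤ N'.lb) (hinf : ¬ ProvenInfeasible P M N)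
      (hupd : IncumbentUpdate P inc ((X done.length N.fixed).map (complete N.fixed)) inc')
      (hkeep : (N.lb : EReal) ≤ upperBound P inc')
      (hk : ∀ i, (P.reduce N.fixed).conflict (X done.length N.fixed) i
        ≤ (P.reduce N.fixed).conflict (X done.length N.fixed) k)
      (h₀ : IsChild P f M N k false N₀) (h₁ : IsChild P f M N k true N₁) :
      Step X ⟨N ::ₘ F, inc, done⟩ ⟨N₀ ::ₘ N₁ ::ₘ F, inc', N :: done⟩

/-- Only the root is open, there is no incumbent, no node has been processed. -/
def IsInitial (s : State n) : Prop := ∃ R, IsRoot P f M R ∧ s = ⟨{R}, none, []⟩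

/-- The states that occur during some execution with the samples `X`. -/
def Reachable (X : Samples n) (s : State n) : Prop :=
  ∃ s₀, IsInitial P f M s₀ ∧ Relation.ReflTransGen (Step P f M X) s₀ s

/-- The stopping criterion: no open node has a bound below the incumbent value (in particular if
there is no open node). -/
def Terminated (s : State n) : Prop := ∀ N ∈ s.frontier, upperBound P s.incumbent ≤ (N.lb : EReal)

end Algorithm

end

end QCBB

/-! Everything rests on one inequality: the Goemans–Williamson bound of a node, plus its constant,
is at most `cᵀx` for every feasible `x` that agrees with the fixed variables. For such an `x` the
penalty `M‖Ax - b‖²` vanishes, so `cᵀx` is the penalized objective, and this is at least the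
Hamiltonian plus the constant (`hamiltonian_add_const_le`). The Hamiltonian at `x` is the total
weight minus twice a cut (`exists_cut_eq_hamiltonian`), hence it remains to bound all cuts from
above by means of `z` (`lbGW_le`). Every cut is at most the value of the semidefinite relaxation,
and random hyperplane rounding recovers the fraction `alphaGW` of that value, up to a correction by
the negative weights. The rounding guarantee combines the separation probability `arccos ⟨u, v⟩ / π`
(`stdGaussian_separation`), linearity of expectation, and an elementary estimate for `arccos`
(`alphaGW_mul_one_sub_cos_le`).

Taking maxima along tree paths preserves validity, because the points of a child's subproblem also
belong to its parent's. Without free variables the graph has no edges and the bound is exact at a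
feasible point.

The rest is the invariant `SearchInvariant`: every feasible point is either no better than the
incumbent or still represented by an open node, and the processed nodes together with the largest
possible subtrees of the open ones fit into a binary tree of depth `n`. The first part gives
correctness at the stopping criterion, the second gives the node counts and finiteness. Samples
affect the search only through the incumbent and the choice of the branching variable, so nothing
about them is needed. -/

/-! ### The scalar inequality behind the approximation ratio -/

lemma sin_le_tangent {x a : ℝ} (hx : x ∈ Set.Icc 0 Real.pi) (ha : a ∈ Set.Icc 0 Real.pi) :
    Real.sin x ≤ Real.sin a + Real.cos a * (x - a) := by
  have hc := strictConcaveOn_sin_Icc.concaveOn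
  rcases lt_trichotomy x a with h | rfl | h
  · have := hc.le_slope_of_hasDerivAt hx ha h (Real.hasDerivAt_sin a)
    rw [slope_def_field, le_div_iff₀ (by linarith)] at this
    linarith
  · simp
  · have := hc.slope_le_of_hasDerivAt ha hx h (Real.hasDerivAt_sin a)
    rw [slope_def_field, div_le_iff₀ (by linarith)] at this
    linarith

/-- Near `π / 4` the tangent to the sine gives a line through the origin that dominates
`1 - cos` with slope at most `(2 / π) / alphaGW`. -/
lemma exists_tangent_point : ∃ a ∈ Set.Icc 0 Real.pi,
    QCBB.alphaGW * Real.cos a ≤ 2 / Real.pi ∧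
      1 + Real.sin a ≤ (Real.pi / 2 + a) * Real.cos a := by
  have hp1 := Real.pi_gt_d20
  have hp2 := Real.pi_lt_d20
  -- The ratio `(2 / π) t / (1 - cos t)` is minimal where `1 - cos t = t sin t`, at `t ≈ 2.331122`.
  -- The value `d` puts `π / 2 + a = 3π / 4 - d` just below this point, so that the tangent there
  -- has nonpositive intercept, while its slope `cos a` still meets the bound with `alphaGW`.
  obtain ⟨d, hd⟩ : ∃ d : ℝ, d = 0.025075 := ⟨_, rfl⟩
  have hdabs : |d| = 0.025075 := by rw [hd]; norm_num
  have hs := abs_le.1 (Real.sin_bound (x := d) (by rw [hdabs]; norm_num))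
  have hc := abs_le.1 (Real.cos_bound (x := d) (by rw [hdabs]; norm_num))
  rw [hdabs, hd] at hs hc
  have hr1 : (1.41421356 : ℝ) ≤ √2 := Real.le_sqrt_of_sq_le (by norm_num)
  have hr2 : √2 ≤ (1.41421357 : ℝ) := by
    rw [Real.sqrt_le_left (by norm_num)]; norm_num
  rw [← hd] at hs hc
  have s1 : (0.0250723 : ℝ) ≤ Real.sin d := by norm_num [hd] at hs ⊢; linarith [hs.1]
  have s2 : Real.sin d ≤ (0.0250724 : ℝ) := by norm_num [hd] at hs ⊢; linarith [hs.2]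
  have c1 : (0.9996855 : ℝ) ≤ Real.cos d := by norm_num [hd] at hc ⊢; linarith [hc.1]
  have c2 : Real.cos d ≤ (0.9996857 : ℝ) := by norm_num [hd] at hc ⊢; linarith [hc.2]
  have hsin : Real.sin (Real.pi / 4 - d) = √2 / 2 * (Real.cos d - Real.sin d) := by
    rw [Real.sin_sub, Real.sin_pi_div_four, Real.cos_pi_div_four]; ring
  have hcos : Real.cos (Real.pi / 4 - d) = √2 / 2 * (Real.cos d + Real.sin d) := by
    rw [Real.cos_sub, Real.sin_pi_div_four, Real.cos_pi_div_four]; ring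
  refine ⟨Real.pi / 4 - d, ⟨by rw [hd]; linarith, by rw [hd]; linarith⟩, ?_, ?_⟩
  · rw [hcos, QCBB.alphaGW, le_div_iff₀ Real.pi_pos]
    have h1 : √2 / 2 * (Real.cos d + Real.sin d) ≤ 1.41421357 / 2 * (0.9996857 + 0.0250724) := by
      gcongr
    calc 0.87856 * (√2 / 2 * (Real.cos d + Real.sin d)) * Real.pi
        ≤ (0.87856 : ℝ) * (1.41421357 / 2 * (0.9996857 + 0.0250724)) * 3.14159265358979323847 := by
          gcongr
      _ ≤ 2 := by norm_num
  · rw [hsin, hcos]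
    have h1 : √2 / 2 * (Real.cos d - Real.sin d) ≤ 1.41421357 / 2 * (0.9996857 - 0.0250723) := by
      gcongr
      · linarith
    have h2 : 1.41421356 / 2 * (0.9996855 + 0.0250723) ≤ √2 / 2 * (Real.cos d + Real.sin d) := by
      gcongr
    have h3 : 2.331119 ≤ Real.pi / 2 + (Real.pi / 4 - d) := by rw [hd]; linarith
    calc 1 + √2 / 2 * (Real.cos d - Real.sin d)
        ≤ (1 : ℝ) + 1.41421357 / 2 * (0.9996857 - 0.0250723) := by linarith
      _ ≤ 2.331119 * (1.41421356 / 2 * (0.9996855 + 0.0250723)) := by norm_num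
      _ ≤ _ := by gcongr

/-- Up to `π / 2` the ratio `1` is already attained, by `1 - cos t ≤ 2t / π`. Beyond, `-cos t = sin
(t - π / 2)` lies below its tangent at the point of `exists_tangent_point`. -/
lemma alphaGW_mul_one_sub_cos_le {t : ℝ} (h0 : 0 ≤ t) (hpi : t ≤ Real.pi) :
    QCBB.alphaGW * ((1 - Real.cos t) / 2) ≤ t / Real.pi := by
  have hp := Real.pi_pos
  suffices QCBB.alphaGW * (1 - Real.cos t) ≤ 2 / Real.pi * t by
    have e : t / Real.pi = (2 / Real.pi * t) / 2 := by ring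
    rw [e]; linarith
  rcases le_total t (Real.pi / 2) with h | h
  · have h1 := Real.one_sub_mul_le_cos h0 h
    have h2 : 0 ≤ 1 - Real.cos t := by linarith [Real.cos_le_one t]
    have h3 : QCBB.alphaGW ≤ 1 := by norm_num [QCBB.alphaGW]
    nlinarith
  · obtain ⟨a, ha, h1, h2⟩ := exists_tangent_point
    have h3 := sin_le_tangent (x := t - Real.pi / 2) ⟨by linarith, by linarith⟩ ha
    rw [Real.sin_sub_pi_div_two] at h3
    have h4 : 1 - Real.cos t ≤ Real.cos a * t := by linarith
    calc QCBB.alphaGW * (1 - Real.cos t) ≤ QCBB.alphaGW * (Real.cos a * t) := by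
          gcongr; norm_num [QCBB.alphaGW]
      _ = QCBB.alphaGW * Real.cos a * t := by ring
      _ ≤ _ := by gcongr

/-! ### The probability that a Gaussian hyperplane separates two vectors -/

/-- The law of a pair of linear functionals of a standard Gaussian vector depends on their
Gram matrix only. -/
lemma map_inner_pair_stdGaussian {E : Type*} [NormedAddCommGroup E] [InnerProductSpace ℝ E]
    [FiniteDimensional ℝ E] [MeasurableSpace E] [BorelSpace E] {u v : E}
    (hu : ‖u‖ = 1) (hv : ‖v‖ = 1) {t : ℝ} (ht : inner ℝ u v = Real.cos t) :
    (stdGaussian E).map (fun r => (inner ℝ u r, inner ℝ v r)) =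
      ((gaussianReal 0 1).prod (gaussianReal 0 1)).map
        (fun q : ℝ × ℝ => (-q.2, Real.sin t * q.1 - Real.cos t * q.2)) := by
  set L : E →L[ℝ] ℝ × ℝ := (innerSL ℝ u).prod (innerSL ℝ v) with hL
  -- The rows of `K` are unit vectors with inner product `cos t`. They are placed so that in polar
  -- coordinates the two functionals become `-r sin φ` and `r sin (t - φ)`.
  set K : ℝ × ℝ →L[ℝ] ℝ × ℝ := (-ContinuousLinearMap.snd ℝ ℝ ℝ).prod
    (Real.sin t • ContinuousLinearMap.fst ℝ ℝ ℝ - Real.cos t • ContinuousLinearMap.snd ℝ ℝ ℝ)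
    with hK
  have hLf : (fun r => (inner ℝ u r, inner ℝ v r)) = ⇑L := by ext r <;> simp [hL]
  have hKf : (fun q : ℝ × ℝ => (-q.2, Real.sin t * q.1 - Real.cos t * q.2)) = ⇑K := by
    ext r <;> simp [hK]
  rw [hLf, hKf]
  have := Measure.isProbabilityMeasure_map (μ := stdGaussian E) L.measurable.aemeasurable
  have := Measure.isProbabilityMeasure_map (μ := (gaussianReal 0 1).prod (gaussianReal 0 1))
    K.measurable.aemeasurable
  -- A functional with coefficients `p`, `q` has under both laws a centred Gaussian distribution of
  -- variance `p² + 2pq cos t + q²`.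
  apply Measure.ext_of_charFunDual
  ext F
  set p := F (1, 0) with hp
  set q := F (0, 1) with hq
  have hF : ∀ x y : ℝ, F (x, y) = x * p + y * q := fun x y => by
    have : ((x, y) : ℝ × ℝ) = x • (1, 0) + y • (0, 1) := by simp
    rw [this, map_add, map_smul, map_smul]; simp [hp, hq]
  have h1 : F ∘SL L = innerSL ℝ (p • u + q • v) := by
    ext r
    simp only [ContinuousLinearMap.comp_apply, hL, ContinuousLinearMap.prod_apply, hF,
      innerSL_apply_apply, inner_add_left, real_inner_smul_left]
    ring
  have hn : ‖p • u + q • v‖ ^ 2 = p ^ 2 + 2 * (p * q * Real.cos t) + q ^ 2 := by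
    rw [norm_add_sq_real, norm_smul, norm_smul, hu, hv, real_inner_smul_left,
      real_inner_smul_right, ht]
    simp; ring
  have hone : ∀ l : StrongDual ℝ ℝ, charFunDual (gaussianReal 0 1) l =
      Complex.exp (-((l 1 : ℝ) : ℂ) ^ 2 / 2) := fun l => by
    have : l = InnerProductSpace.toDualMap ℝ ℝ (l 1) := by ext; simp
    conv_lhs => rw [this]
    rw [← charFun_eq_charFunDual_toDualMap, charFun_gaussianReal]
    simp [neg_div]
  rw [charFunDual_map, charFunDual_map, h1, charFunDual_stdGaussian, charFunDual_prod, hone, hone,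
    ← Complex.exp_add, innerSL_apply_norm]
  congr 1
  norm_cast
  rw [hn]
  simp only [ContinuousLinearMap.comp_apply, hK, ContinuousLinearMap.prod_apply, hF,
    ContinuousLinearMap.inl_apply, ContinuousLinearMap.inr_apply]
  simp
  have := Real.sin_sq_add_cos_sq t
  linear_combination (q ^ 2 / 2) * this

/-- The standard Gaussian measure of a planar cone is proportional to its angle. -/
lemma gaussian_prod_cone {T : Set (ℝ × ℝ)} (hT : MeasurableSet T) {S : Set ℝ}
    (hS : MeasurableSet S)
    (h : ∀ r φ : ℝ, 0 < r → φ ∈ Set.Ioo (-Real.pi) Real.pi →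
      ((r * Real.cos φ, r * Real.sin φ) ∈ T ↔ φ ∈ S)) :
    ((gaussianReal 0 1).prod (gaussianReal 0 1)) T =
      volume (S ∩ Set.Ioo (-Real.pi) Real.pi) / ENNReal.ofReal (2 * Real.pi) := by
  -- The radial integral splits off as a factor that does not depend on the cone. It need not be
  -- evaluated: the whole plane has measure 1 and angle `2π`, which determines it.
  obtain ⟨C, hC⟩ : ∃ C : ENNReal, ∀ (T : Set (ℝ × ℝ)), MeasurableSet T → ∀ S : Set ℝ,
      MeasurableSet S → (∀ r φ : ℝ, 0 < r → φ ∈ Set.Ioo (-Real.pi) Real.pi →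
        ((r * Real.cos φ, r * Real.sin φ) ∈ T ↔ φ ∈ S)) →
      ((gaussianReal 0 1).prod (gaussianReal 0 1)) T =
        C * volume (S ∩ Set.Ioo (-Real.pi) Real.pi) := by
    let g : ℝ → ENNReal := fun r =>
      ENNReal.ofReal r * ENNReal.ofReal ((2 * Real.pi)⁻¹ * Real.exp (-r ^ 2 / 2))
    refine ⟨∫⁻ r in Set.Ioi (0 : ℝ), g r, fun T hT S hS h => ?_⟩
    rw [gaussianReal_of_var_ne_zero _ one_ne_zero,
      prod_withDensity (measurable_gaussianPDF _ _) (measurable_gaussianPDF _ _),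
      withDensity_apply _ hT, ← lintegral_indicator hT, ← Measure.volume_eq_prod,
      ← lintegral_comp_polarCoord_symm]
    have hg : Measurable g := by fun_prop
    have key : ∀ p ∈ polarCoord.target, ENNReal.ofReal p.1 • T.indicator
        (fun z : ℝ × ℝ => gaussianPDF 0 1 z.1 * gaussianPDF 0 1 z.2) (polarCoord.symm p) =
        g p.1 * S.indicator 1 p.2 := by
      rintro ⟨r, φ⟩ hp
      have hp' : 0 < r ∧ φ ∈ Set.Ioo (-Real.pi) Real.pi := by simpa [polarCoord] using hp
      have hm := h r φ hp'.1 hp'.2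
      simp only [polarCoord_symm_apply, smul_eq_mul]
      by_cases hφ : φ ∈ S
      · rw [Set.indicator_of_mem (hm.2 hφ), Set.indicator_of_mem hφ]
        simp only [g, Pi.one_apply, mul_one, gaussianPDF]
        rw [← ENNReal.ofReal_mul (gaussianPDFReal_nonneg _ _ _)]
        congr 2
        simp only [gaussianPDFReal, NNReal.coe_one, mul_one, sub_zero]
        have e : (√(2 * Real.pi))⁻¹ * (√(2 * Real.pi))⁻¹ = (2 * Real.pi)⁻¹ := by
          rw [← mul_inv, Real.mul_self_sqrt (by positivity)]
        rw [mul_mul_mul_comm, e, ← Real.exp_add]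
        congr 2
        have := Real.sin_sq_add_cos_sq φ
        linear_combination (-r ^ 2 / 2) * this
      · rw [Set.indicator_of_notMem (fun h' => hφ (hm.1 h')), Set.indicator_of_notMem hφ]
        simp
    rw [setLIntegral_congr_fun polarCoord.open_target.measurableSet key]
    have : polarCoord.target = Set.Ioi (0 : ℝ) ×ˢ Set.Ioo (-Real.pi) Real.pi := rfl
    rw [this, Measure.volume_eq_prod, ← Measure.prod_restrict,
      lintegral_prod_mul (g := S.indicator 1) hg.aemeasurable
        (measurable_one.indicator hS).aemeasurable, lintegral_indicator_one hS,
      Measure.restrict_apply hS]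
  have hu := hC Set.univ MeasurableSet.univ Set.univ MeasurableSet.univ (by simp)
  rw [measure_univ, Set.univ_inter, Real.volume_Ioo,
    show Real.pi - -Real.pi = 2 * Real.pi by ring] at hu
  have h0 : ENNReal.ofReal (2 * Real.pi) ≠ 0 := by simp [Real.pi_pos]
  rw [hC T hT S hS h, ENNReal.eq_div_iff h0 ENNReal.ofReal_ne_top, ← mul_assoc,
    mul_comm _ C, ← hu, one_mul]

/-- The two sign conditions hold on the half-circles `φ ≤ 0` and `t - π ≤ φ ≤ t`, which are
rotations of each other by `t` up to endpoints. They differ in two arcs of length `t`. -/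
lemma angle_of_separation_iff {t φ : ℝ} (h0 : 0 ≤ t) (hpi : t ≤ Real.pi)
    (hφ : φ ∈ Set.Ioo (-Real.pi) Real.pi) :
    (¬ (0 ≤ -Real.sin φ ↔ 0 ≤ Real.sin (t - φ))) ↔
      φ ∈ Set.Ioo (-Real.pi) (t - Real.pi) ∪ Set.Ioc 0 t := by
  obtain ⟨h1, h2⟩ := hφ
  rcases le_or_gt φ 0 with h | h
  · have hs : 0 ≤ -Real.sin φ := by
      rw [← Real.sin_neg]; exact Real.sin_nonneg_of_nonneg_of_le_pi (by linarith) (by linarith)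
    have hn : φ ∉ Set.Ioc 0 t := fun h' => absurd h'.1 (not_lt.2 h)
    simp only [hs, true_iff, Set.mem_union, hn, or_false, Set.mem_Ioo, h1, true_and, not_le]
    constructor
    · intro h3
      by_contra h4
      exact absurd (Real.sin_nonneg_of_nonneg_of_le_pi (x := t - φ) (by linarith) (by linarith))
        (not_le.2 h3)
    · intro h3
      have := Real.sin_pos_of_pos_of_lt_pi (x := t - φ - Real.pi) (by linarith) (by linarith)
      rw [Real.sin_sub_pi] at this
      linarith
  · have hs : ¬ 0 ≤ -Real.sin φ := by
      have := Real.sin_pos_of_pos_of_lt_pi h h2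
      linarith
    have hn : φ ∉ Set.Ioo (-Real.pi) (t - Real.pi) := fun h' => by
      have := h'.2; linarith
    simp only [hs, false_iff, Set.mem_union, hn, false_or, Set.mem_Ioc, h, true_and, not_not]
    constructor
    · intro h3
      by_contra h4
      exact absurd (Real.sin_neg_of_neg_of_neg_pi_lt (x := t - φ) (by linarith) (by linarith))
        (not_lt.2 h3)
    · intro h3
      exact Real.sin_nonneg_of_nonneg_of_le_pi (by linarith) (by linarith)

/-- Only the plane spanned by the two functionals matters, and there the separating directions form
two arcs of total length `2t` out of `2π`. -/
lemma stdGaussian_separation {E : Type*} [NormedAddCommGroup E] [InnerProductSpace ℝ E]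
    [FiniteDimensional ℝ E] [MeasurableSpace E] [BorelSpace E] {u v : E}
    (hu : ‖u‖ = 1) (hv : ‖v‖ = 1) :
    (stdGaussian E).real {r | ¬ (0 ≤ inner ℝ u r ↔ 0 ≤ inner ℝ v r)} =
      Real.arccos (inner ℝ u v) / Real.pi := by
  have hin := abs_le.1 (by simpa [hu, hv] using abs_real_inner_le_norm u v)
  set t := Real.arccos (inner ℝ u v) with ht
  have h0 : 0 ≤ t := Real.arccos_nonneg _
  have hpi : t ≤ Real.pi := Real.arccos_le_pi _
  have hcos : inner ℝ u v = Real.cos t := (Real.cos_arccos hin.1 hin.2).symm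
  let B : Set (ℝ × ℝ) := {q | ¬ (0 ≤ q.1 ↔ 0 ≤ q.2)}
  have hB : MeasurableSet B := by
    have a : MeasurableSet {q : ℝ × ℝ | 0 ≤ q.1} := measurableSet_le (by fun_prop) (by fun_prop)
    have b : MeasurableSet {q : ℝ × ℝ | 0 ≤ q.2} := measurableSet_le (by fun_prop) (by fun_prop)
    exact (a.iff b).compl
  have e1 : stdGaussian E {r | ¬ (0 ≤ inner ℝ u r ↔ 0 ≤ inner ℝ v r)} =
      (stdGaussian E).map (fun r => (inner ℝ u r, inner ℝ v r)) B := by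
    rw [Measure.map_apply (by fun_prop) hB]; rfl
  rw [Measure.real, e1, map_inner_pair_stdGaussian hu hv hcos, Measure.map_apply (by fun_prop) hB,
    gaussian_prod_cone (S := Set.Ioo (-Real.pi) (t - Real.pi) ∪ Set.Ioc 0 t)
      (hB.preimage (by fun_prop)) (measurableSet_Ioo.union measurableSet_Ioc)]
  · have hv : volume ((Set.Ioo (-Real.pi) (t - Real.pi) ∪ Set.Ioc 0 t) ∩
        Set.Ioo (-Real.pi) Real.pi) = ENNReal.ofReal (2 * t) := by
      -- The intersection can lose only the angle `π`, and only for `t = π`.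
      have : ((Set.Ioo (-Real.pi) (t - Real.pi) ∪ Set.Ioc 0 t) ∩ Set.Ioo (-Real.pi) Real.pi :
          Set ℝ) =ᵐ[volume] (Set.Ioo (-Real.pi) (t - Real.pi) ∪ Set.Ioc 0 t : Set ℝ) := by
        have hc : (Set.Ioo (-Real.pi) Real.pi : Set ℝ) =ᵐ[volume] Set.Icc (-Real.pi) Real.pi :=
          Ioo_ae_eq_Icc
        refine ((Filter.EventuallyEq.refl _ _).inter hc).trans (Filter.EventuallyEq.of_eq ?_)
        apply Set.inter_eq_left.2
        rintro x (hx | hx)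
        · exact ⟨hx.1.le, by linarith [hx.2]⟩
        · exact ⟨by linarith [hx.1], by linarith [hx.2]⟩
      rw [measure_congr this, measure_union _ measurableSet_Ioc, Real.volume_Ioo, Real.volume_Ioc,
        ← ENNReal.ofReal_add (by linarith) (by linarith)]
      · congr 1; ring
      · rw [Set.disjoint_left]
        rintro x hx hx'
        linarith [hx.2, hx'.1]
    rw [hv, ← ENNReal.ofReal_div_of_pos (by positivity), ENNReal.toReal_ofReal (by positivity)]
    field_simp
  · intro r φ hr hφ
    rw [← angle_of_separation_iff h0 hpi hφ]
    have e2 : Real.sin t * (r * Real.cos φ) - Real.cos t * (r * Real.sin φ) =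
        r * Real.sin (t - φ) := by rw [Real.sin_sub]; ring
    have e3 : -(r * Real.sin φ) = r * -Real.sin φ := by ring
    simp only [B, Set.mem_preimage, Set.mem_ofPred_eq]
    rw [e2, e3, mul_nonneg_iff_of_pos_left hr, mul_nonneg_iff_of_pos_left hr]

namespace QCBB

/-! ### The Goemans–Williamson value -/

section MaxCut

variable {V : Type} [Fintype V]

lemma integral_cutValue (w : V → V → ℝ) {y : V → EuclideanSpace ℝ V} (hy : ∀ u, ‖y u‖ = 1) :
    ∫ r, cutValue w (hyperplaneSide y r) ∂(stdGaussian (EuclideanSpace ℝ V)) =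
      ∑ u, ∑ v, w u v * (Real.arccos (inner ℝ (y u) (y v)) / Real.pi) := by
  classical
  let D : V → V → Set (EuclideanSpace ℝ V) := fun u v =>
    {r | ¬ (0 ≤ inner ℝ (y u) r ↔ 0 ≤ inner ℝ (y v) r)}
  have hD : ∀ u v, MeasurableSet (D u v) := fun u v => by
    have h : ∀ u, MeasurableSet {r : EuclideanSpace ℝ V | 0 ≤ inner ℝ (y u) r} := fun u =>
      measurableSet_le (by fun_prop) (by fun_prop)
    exact ((h u).iff (h v)).compl
  have hcut : ∀ r, cutValue w (hyperplaneSide y r) =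
      ∑ u, ∑ v, (D u v).indicator (fun _ => w u v) r := fun r => by
    refine Finset.sum_congr rfl fun u _ => Finset.sum_congr rfl fun v _ => ?_
    simp only [hyperplaneSide, Set.indicator, D, Set.mem_ofPred_eq]
    split_ifs <;> simp_all
  have hD_integrable : ∀ u v, Integrable ((D u v).indicator (fun _ => w u v))
      (stdGaussian (EuclideanSpace ℝ V)) := fun u v => (integrable_const _).indicator (hD u v)
  simp_rw [hcut]
  rw [integral_finsetSum _ fun u _ => integrable_finsetSum _ fun v _ => hD_integrable u v]
  refine Finset.sum_congr rfl fun u _ => ?_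
  rw [integral_finsetSum _ fun v _ => hD_integrable u v]
  refine Finset.sum_congr rfl fun v _ => ?_
  rw [integral_indicator_const _ (hD u v), stdGaussian_separation (hy u) (hy v), smul_eq_mul,
    mul_comm]

open Classical in
-- For `w ≥ 0` this is the scalar inequality at `arccos s`. For `w < 0` an upper bound on the
-- separation probability is needed; since `arccos (-s) = π - arccos s`, the scalar inequality at
-- `-s` provides it, at the cost of the term `1 - alphaGW`.
lemma edge_bound (w : ℝ) {s : ℝ} (h1 : -1 ≤ s) (h2 : s ≤ 1) :
    alphaGW * (w * ((1 - s) / 2)) + (1 - alphaGW) * (if w < 0 then w else 0) ≤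
      w * (Real.arccos s / Real.pi) := by
  have hpi := Real.pi_pos
  have e := alphaGW_mul_one_sub_cos_le (Real.arccos_nonneg s) (Real.arccos_le_pi s)
  rw [Real.cos_arccos h1 h2] at e
  have e' := alphaGW_mul_one_sub_cos_le (Real.arccos_nonneg (-s)) (Real.arccos_le_pi (-s))
  rw [Real.cos_arccos (by linarith) (by linarith), Real.arccos_neg,
    sub_div Real.pi, div_self hpi.ne'] at e'
  split_ifs with hw <;> nlinarith

lemma alphaGW_mul_sdpValue_le (w : V → V → ℝ) {z : ℝ} {y : V → EuclideanSpace ℝ V}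
    (hy : ∀ u, ‖y u‖ = 1)
    (hz : z = ∫ r, cutValue w (hyperplaneSide y r) ∂(stdGaussian (EuclideanSpace ℝ V))) :
    alphaGW * sdpValue w y + (1 - alphaGW) * negWeight w ≤ z := by
  rw [hz, integral_cutValue w hy, sdpValue, negWeight, Finset.mul_sum, Finset.mul_sum,
    ← Finset.sum_add_distrib]
  refine Finset.sum_le_sum fun u _ => ?_
  rw [Finset.mul_sum, Finset.mul_sum, ← Finset.sum_add_distrib]
  refine Finset.sum_le_sum fun v _ => ?_
  have hin := abs_le.1 (by simpa [hy u, hy v] using abs_real_inner_le_norm (y u) (y v))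
  exact edge_bound (w u v) hin.1 hin.2

/-- A cut is a feasible point of the relaxation whose vectors are all `e` or `-e`; a vertex is
needed for a unit vector `e` to exist. -/
lemma cutValue_le_sdpValue [Nonempty V] {w : V → V → ℝ} {y : V → EuclideanSpace ℝ V}
    (hy : IsSDPOptimal w y) (S : Set V) : cutValue w S ≤ sdpValue w y := by
  classical
  obtain ⟨v₀⟩ := ‹Nonempty V›
  let e : EuclideanSpace ℝ V := EuclideanSpace.single v₀ 1
  have he : ‖e‖ = 1 := by simp [e]
  let y' : V → EuclideanSpace ℝ V := fun u => if u ∈ S then e else -e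
  have hy' : ∀ u, ‖y' u‖ = 1 := fun u => by
    simp only [y']; split_ifs <;> simp [he]
  refine le_trans (le_of_eq ?_) (hy.2 y' hy')
  refine Finset.sum_congr rfl fun u _ => Finset.sum_congr rfl fun v _ => ?_
  by_cases hu : u ∈ S <;> by_cases hv : v ∈ S <;> simp [y', hu, hv, he]

/-- The Goemans–Williamson value yields a lower bound on the total weight minus twice any cut. -/
lemma lbGW_le [Nonempty V] {w : V → V → ℝ} {z : ℝ} (hz : IsGWValue w z) (S : Set V) :
    lbGW w z ≤ totalWeight w - 2 * cutValue w S := by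
  obtain ⟨y, hy, hzy⟩ := hz
  have h1 := alphaGW_mul_sdpValue_le w hy.1 hzy
  have h2 := cutValue_le_sdpValue hy S
  have ha : (0 : ℝ) < alphaGW := by norm_num [alphaGW]
  have h3 : sdpValue w y ≤ (z - (1 - alphaGW) * negWeight w) / alphaGW := by
    rw [le_div_iff₀ ha]; linarith
  have h4 : (z - (1 - alphaGW) * negWeight w) / alphaGW =
      z / alphaGW - negWeight w / alphaGW + negWeight w := by field_simp; ring
  have h5 : lbGW w z = -2 * (z / alphaGW) + 2 * (negWeight w / alphaGW) - 2 * negWeight w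
      + totalWeight w := by rw [lbGW]; ring
  rw [h5]; linarith

/-- The relaxation has an optimal solution by compactness of a product of spheres. Hence the root
and the children of any node exist, so that the search can start and continue. -/
lemma exists_isGWValue [Nonempty V] (w : V → V → ℝ) : ∃ z, IsGWValue w z := by
  classical
  let K : Set (V → EuclideanSpace ℝ V) := Set.univ.pi fun _ => Metric.sphere 0 1
  have hK : IsCompact K := isCompact_univ_pi fun _ => isCompact_sphere _ _
  obtain ⟨v₀⟩ := ‹Nonempty V›
  have hne : K.Nonempty := ⟨fun _ => EuclideanSpace.single v₀ 1, fun _ _ => by simp⟩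
  have hcont : Continuous (sdpValue w) := by unfold sdpValue; fun_prop
  obtain ⟨y, hyK, hy⟩ := hK.exists_isMaxOn hne hcont.continuousOn
  have hmem : ∀ y : V → EuclideanSpace ℝ V, y ∈ K ↔ ∀ u, ‖y u‖ = 1 := fun y => by simp [K]
  exact ⟨_, y, ⟨(hmem y).1 hyK, fun y' hy' => hy ((hmem y').2 hy')⟩, rfl⟩

end MaxCut

/-! ### The Hamiltonian is a lower bound for the penalized objective -/

section Ising

lemma gram_symm {m : ℕ} {ι : Type} (P : BLP m ι) (i k : ι) : P.gram i k = P.gram k i := by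
  simp [BLP.gram, Matrix.mul_apply, mul_comm]

variable {m : ℕ} {ι : Type} [Fintype ι]

/-- The spin `±1` encoded by a Boolean. -/
noncomputable def spin (v : Bool) : ℝ := 2 * bit v - 1

lemma spin_mul_self (v : Bool) : spin v * spin v = 1 := by
  cases v <;> norm_num [spin, bit]

lemma sum_gram_mul (P : BLP m ι) (s t : ι → ℝ) :
    ∑ i, ∑ k, P.gram i k * (s i * t k) =
      ∑ j, (∑ i, P.A j i * s i) * (∑ k, P.A j k * t k) := by
  simp_rw [BLP.gram, Matrix.mul_apply, Matrix.transpose_apply, Finset.sum_mul, Finset.mul_sum]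
  rw [Finset.sum_comm' (t' := Finset.univ) (s' := fun _ => Finset.univ) (by simp)]
  simp_rw [Finset.sum_comm (s := Finset.univ (α := ι)) (t := Finset.univ (α := Fin m))]
  refine Finset.sum_congr rfl fun j _ => ?_
  rw [Finset.sum_comm]
  refine Finset.sum_congr rfl fun i _ => Finset.sum_congr rfl fun k _ => ?_
  ring

lemma sum_lt_of_symm [LinearOrder ι] {g : ι → ι → ℝ} (hg : ∀ i k, g i k = g k i) :
    ∑ i, ∑ k, g i k = 2 * (∑ i, ∑ k, if i < k then g i k else 0) + ∑ i, g i i := by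
  have h1 : ∀ i k, g i k = (if i < k then g i k else 0) + (if k < i then g k i else 0)
      + (if i = k then g i i else 0) := fun i k => by
    rcases lt_trichotomy i k with h | rfl | h
    · simp [h, h.not_gt, h.ne]
    · simp
    · simp [h, h.not_gt, h.ne', hg i k]
  have h2 : ∑ i, ∑ k, (if k < i then g k i else 0) = ∑ i, ∑ k, (if i < k then g i k else 0) :=
    Finset.sum_comm
  conv_lhs => enter [2, i, 2, k]; rw [h1]
  simp only [Finset.sum_add_distrib, h2, Finset.sum_ite_eq, Finset.mem_univ, if_true]
  ring

variable [LinearOrder ι]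

/-- The value of the Hamiltonian is the total weight minus twice the weight of a cut. -/
lemma exists_cut_eq_hamiltonian (P : BLP m ι) (f : IsingForm) (M : ℝ) (x : ι → Bool) :
    ∃ S : Set (Option ι), totalWeight (P.cutWeight f M) - 2 * cutValue (P.cutWeight f M) S =
      1 / 2 * (∑ i, P.h M i * spin (x i)) + f.couplingCoeff * M *
        (∑ i, ∑ k, if i < k then P.gram i k * (spin (x i) * spin (x k)) else 0) := by
  classical
  -- With spin `1` at the additional vertex, the edges at that vertex reproduce the linear terms.
  let σ : Option ι → Bool := fun o => o.elim true x
  refine ⟨{o | σ o = true}, ?_⟩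
  have hspin : ∀ u v, (P.cutWeight f M u v) - 2 * (if (σ u = true ↔ σ v = true) then 0 else
      P.cutWeight f M u v) = P.cutWeight f M u v * (spin (σ u) * spin (σ v)) := fun u v => by
    cases σ u <;> cases σ v <;> norm_num [spin, bit] <;> ring
  have : totalWeight (P.cutWeight f M) - 2 * cutValue (P.cutWeight f M) {o | σ o = true} =
      ∑ u, ∑ v, P.cutWeight f M u v * (spin (σ u) * spin (σ v)) := by
    simp only [totalWeight, cutValue, Finset.mul_sum, ← Finset.sum_sub_distrib, Set.mem_ofPred_eq]
    exact Finset.sum_congr rfl fun u _ => Finset.sum_congr rfl fun v _ => by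
      rw [← hspin u v]; congr
  rw [this]
  have s1 : spin true = 1 := by norm_num [spin, bit]
  simp only [Fintype.sum_option, BLP.cutWeight, σ, Option.elim, zero_mul, zero_add, s1, one_mul,
    Finset.mul_sum]
  congr 1
  · refine Finset.sum_congr rfl fun i _ => ?_
    rw [mu]; ring
  · refine Finset.sum_congr rfl fun i _ => Finset.sum_congr rfl fun k _ => ?_
    simp only [BLP.J, Matrix.smul_apply, smul_eq_mul]
    split_ifs <;> ring

/-- Substituting `x = (s + 1) / 2` turns the quadratic part of the penalty into `(M / 4) ∑ p j ^ 2`,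
where `p = A s`. As `s i ^ 2 = 1`, its diagonal part is constant, `(M / 4) tr (AᵀA)`. -/
lemma hamiltonian_add_const_le (P : BLP m ι) (f : IsingForm) {M : ℝ} (hM : 0 ≤ M)
    (x : ι → Bool) :
    1 / 2 * (∑ i, P.h M i * spin (x i)) + f.couplingCoeff * M *
        (∑ i, ∑ k, if i < k then P.gram i k * (spin (x i) * spin (x k)) else 0) + P.const f M ≤
      P.obj x + M * ∑ j, (∑ i, P.A j i * bit (x i) - P.b j) ^ 2 := by
  set s : ι → ℝ := fun i => spin (x i) with hs
  have hbit : ∀ i, bit (x i) = (s i + 1) / 2 := fun i => by simp only [hs, spin]; ring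
  set a : Fin m → ℝ := fun j => ∑ i, P.A j i with ha
  set p : Fin m → ℝ := fun j => ∑ i, P.A j i * s i with hp
  have g1 : ∑ i, ∑ k, P.gram i k * (s i * s k) = ∑ j, p j ^ 2 := by
    rw [sum_gram_mul]; exact Finset.sum_congr rfl fun j _ => by rw [hp]; ring
  have g2 : ∑ i, ∑ k, P.gram i k = ∑ j, a j ^ 2 := by
    have := sum_gram_mul P (fun _ => 1) (fun _ => 1)
    simp only [mul_one] at this
    rw [this]; exact Finset.sum_congr rfl fun j _ => by rw [ha]; ring
  have g3 : ∑ i, (∑ k, P.gram k i) * s i = ∑ j, a j * p j := by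
    have := sum_gram_mul P (fun _ => 1) s
    simp only [mul_one, one_mul] at this
    rw [← this, Finset.sum_comm]
    exact Finset.sum_congr rfl fun i _ => Finset.sum_mul _ _ _
  have g4 : ∑ i, (∑ j, P.b j * P.A j i) * s i = ∑ j, P.b j * p j := by
    simp only [hp, Finset.sum_mul, Finset.mul_sum]
    rw [Finset.sum_comm]
    exact Finset.sum_congr rfl fun i _ => Finset.sum_congr rfl fun j _ => by ring
  have g5 : ∑ j, ∑ i, P.b j * P.A j i = ∑ j, P.b j * a j := by
    simp only [ha, Finset.mul_sum]
  have g6 : ∑ i, P.h M i * s i = ∑ i, P.c i * s i - 2 * M * (∑ j, P.b j * p j)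
      + M * ∑ j, a j * p j := by
    rw [← g3, ← g4, Finset.mul_sum, Finset.mul_sum, ← Finset.sum_sub_distrib,
      ← Finset.sum_add_distrib]
    exact Finset.sum_congr rfl fun i _ => by rw [BLP.h]; ring
  have g7 : P.obj x = 1 / 2 * (∑ i, P.c i * s i) + 1 / 2 * (∑ i, P.c i) + P.offset := by
    rw [BLP.obj, Finset.mul_sum, Finset.mul_sum, ← Finset.sum_add_distrib]
    congr 1
    exact Finset.sum_congr rfl fun i _ => by rw [hbit]; ring
  have g8 : ∑ j, (∑ i, P.A j i * bit (x i) - P.b j) ^ 2 = 1 / 4 * (∑ j, p j ^ 2)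
      + 1 / 2 * (∑ j, a j * p j) + 1 / 4 * (∑ j, a j ^ 2) - (∑ j, P.b j * p j)
      - (∑ j, P.b j * a j) + ∑ j, P.b j * P.b j := by
    simp only [Finset.mul_sum, ← Finset.sum_sub_distrib, ← Finset.sum_add_distrib]
    refine Finset.sum_congr rfl fun j _ => ?_
    have : ∑ i, P.A j i * bit (x i) = (p j + a j) / 2 := by
      simp only [hp, ha, ← Finset.sum_add_distrib, Finset.sum_div]
      exact Finset.sum_congr rfl fun i _ => by rw [hbit]; ring
    rw [this]; ring
  have g9 := sum_lt_of_symm (g := fun i k => P.gram i k * (s i * s k))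
    (fun i k => by rw [gram_symm, mul_comm (s i)])
  have g10 : ∑ i, P.gram i i * (s i * s i) = P.gram.trace := by
    simp only [hs, spin_mul_self, mul_one]; rfl
  have g11 : P.gram.trace = ∑ j, ∑ i, P.A j i ^ 2 := by
    simp only [Matrix.trace, Matrix.diag, BLP.gram, Matrix.mul_apply, Matrix.transpose_apply]
    rw [Finset.sum_comm]
    exact Finset.sum_congr rfl fun i _ => Finset.sum_congr rfl fun j _ => by ring
  have htr : 0 ≤ P.gram.trace := by rw [g11]; positivity
  have hq : 0 ≤ ∑ j, p j ^ 2 := by positivity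
  simp only [g10, g1] at g9
  rw [BLP.const, BLP.transformConst, g2, g5, g6, g7, g8]
  -- In the form `quarter`, the right side exceeds the left by `(M / 8) (∑ p j ^ 2 + tr (AᵀA)) ≥ 0`;
  -- in the form `half`, both sides agree.
  cases f
  · simp only [IsingForm.couplingCoeff, IsingForm.diagCoeff]
    nlinarith [mul_nonneg hM htr, mul_nonneg hM hq]
  · simp only [IsingForm.couplingCoeff, IsingForm.diagCoeff]
    nlinarith

lemma lbGW_add_const_le (P : BLP m ι) (f : IsingForm) {M : ℝ} (hM : 0 ≤ M) {z : ℝ}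
    (hz : IsGWValue (P.cutWeight f M) z) {x : ι → Bool} (hx : P.Feasible x) :
    lbGW (P.cutWeight f M) z + P.const f M ≤ P.obj x := by
  obtain ⟨S, hS⟩ := exists_cut_eq_hamiltonian P f M x
  have h1 := lbGW_le hz S
  have h2 := hamiltonian_add_const_le P f hM x
  have h3 : ∑ j, (∑ i, P.A j i * bit (x i) - P.b j) ^ 2 = 0 :=
    Finset.sum_eq_zero fun j _ => by rw [show _ = _ from hx j]; ring
  rw [h3] at h2
  linarith

end Ising

/-! ### Reduced problems -/

section Reduce

variable {m n : ℕ}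

lemma sum_eq_sum_free_add_fixed {p : Partial n} {x : Fin n → Bool} (hx : Extends x p)
    (a : Fin n → ℝ) :
    ∑ k, a k * bit (x k) = ∑ i : Free p, a i * bit (x i) + ∑ k, fixedTerm (a k) (p k) := by
  have h1 : ∑ i : Free p, a i * bit (x i) = ∑ k, if p k = none then a k * bit (x k) else 0 := by
    rw [← Finset.sum_filter]
    exact (Finset.sum_subtype _ (by simp) (fun k => a k * bit (x k))).symm
  rw [h1, ← Finset.sum_add_distrib]
  refine Finset.sum_congr rfl fun k _ => ?_
  cases h : p k with
  | none => simp [fixedTerm]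
  | some v => simp [fixedTerm, hx k v h]

lemma reduce_obj (P : BLP m (Fin n)) {p : Partial n} {x : Fin n → Bool} (hx : Extends x p) :
    (P.reduce p).obj (fun i => x i) = P.obj x := by
  rw [BLP.obj, BLP.obj, sum_eq_sum_free_add_fixed hx]
  simp only [BLP.reduce]
  ring

lemma reduce_rowHolds (P : BLP m (Fin n)) {p : Partial n} {x : Fin n → Bool} (hx : Extends x p)
    (j : Fin m) : (P.reduce p).RowHolds j (fun i => x i) ↔ P.RowHolds j x := by
  rw [BLP.RowHolds, BLP.RowHolds, sum_eq_sum_free_add_fixed hx]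
  simp only [BLP.reduce, Matrix.submatrix_apply, id_eq]
  constructor <;> intro h <;> linarith

lemma extends_complete (p : Partial n) (y : Free p → Bool) : Extends (complete p y) p := by
  intro i v h
  simp [complete, h]

lemma extends_of_extends_update {p : Partial n} {k : Fin n} (hk : p k = none) {v : Bool}
    {x : Fin n → Bool} (hx : Extends x (Function.update p k (some v))) : Extends x p := by
  intro i w hi
  have hne : i ≠ k := by rintro rfl; simp [hk] at hi
  exact hx i w (by rw [Function.update_of_ne hne, hi])

lemma extends_update {p : Partial n} {x : Fin n → Bool} (hx : Extends x p) (k : Fin n) :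
    Extends x (Function.update p k (some (x k))) := by
  intro i w hi
  by_cases h : i = k
  · subst h; simpa using hi
  · exact hx i w (by rwa [Function.update_of_ne h] at hi)

lemma Extends.eq {p : Partial n} (hp : ∀ i, p i ≠ none) {x y : Fin n → Bool}
    (hx : Extends x p) (hy : Extends y p) : x = y := by
  funext i
  obtain ⟨v, hv⟩ := Option.ne_none_iff_exists'.1 (hp i)
  rw [hx i v hv, hy i v hv]

lemma exists_extends (p : Partial n) : ∃ x, Extends x p :=
  ⟨complete p fun _ => false, extends_complete _ _⟩

/-- The number of free variables. -/
def freeCount (p : Partial n) : ℕ := (Finset.univ.filter fun i => p i = none).card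

lemma freeCount_update {p : Partial n} {k : Fin n} (hk : p k = none) (v : Bool) :
    freeCount (Function.update p k (some v)) + 1 = freeCount p := by
  have : (Finset.univ.filter fun i => Function.update p k (some v) i = none) =
      (Finset.univ.filter fun i => p i = none).erase k := by
    ext i
    by_cases h : i = k
    · subst h; simp
    · simp [h]
  rw [freeCount, this, Finset.card_erase_add_one (by simp [hk])]
  rfl

lemma freeCount_pos {N : Node n} (h : N.HasFree) : 0 < freeCount N.fixed := by
  obtain ⟨i, hi⟩ := h
  exact Finset.card_pos.2 ⟨i, by simp [hi]⟩

variable {P : BLP m (Fin n)}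

lemma Propagates.extends_of_extends {p p' : Partial n} (h : Propagates P p p') {x : Fin n → Bool}
    (hx : Extends x p') : Extends x p := by
  induction h with
  | refl => exact hx
  | tail _ hs ih =>
    obtain ⟨j, i, v, hi, -, rfl⟩ := hs
    exact ih (extends_of_extends_update hi hx)

/-- A feasible point satisfies the constraint that forces a value, so propagation never cuts it off.
-/
lemma Propagates.extends_of_feasible {p p' : Partial n} (h : Propagates P p p')
    {x : Fin n → Bool} (hx : Extends x p) (hf : P.Feasible x) : Extends x p' := by
  induction h with
  | refl => exact hx
  | tail _ hs ih =>
    obtain ⟨j, i, v, -, hv, rfl⟩ := hs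
    rw [← hv x ih (hf j)]
    exact extends_update ih i

lemma Propagates.freeCount_le {p p' : Partial n} (h : Propagates P p p') :
    freeCount p' ≤ freeCount p := by
  induction h with
  | refl => exact le_rfl
  | tail _ hs ih =>
    obtain ⟨j, i, v, hi, -, rfl⟩ := hs
    have := freeCount_update hi v
    lia

end Reduce

/-! ### Bounds of tree nodes -/

section Tree

variable {m n : ℕ} {P : BLP m (Fin n)} {f : IsingForm} {M : ℝ}

lemma IsLocalBound.le_obj (hM : 0 ≤ M) {p : Partial n} {g : ℝ} (hg : IsLocalBound P f M p g)
    {x : Fin n → Bool} (hx : Extends x p) (hf : P.Feasible x) : g ≤ P.obj x := by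
  obtain ⟨z, hz, rfl⟩ := hg
  rw [← reduce_obj P hx]
  exact lbGW_add_const_le _ f hM hz fun j => (reduce_rowHolds P hx j).2 (hf j)

variable (P f M) in
lemma exists_isLocalBound (p : Partial n) : ∃ g, IsLocalBound P f M p g := by
  obtain ⟨z, hz⟩ := exists_isGWValue ((P.reduce p).cutWeight f M)
  exact ⟨_, z, hz, rfl⟩

/-- Only the additional vertex is left and all weights vanish. -/
lemma lbGW_cutWeight_of_isEmpty {ι : Type} [Fintype ι] [LinearOrder ι] [IsEmpty ι] (Q : BLP m ι)
    {z : ℝ} (hz : IsGWValue (Q.cutWeight f M) z) : lbGW (Q.cutWeight f M) z = 0 := by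
  have hw : Q.cutWeight f M = fun _ _ => 0 := by
    funext u v
    cases u with
    | some i => exact isEmptyElim i
    | none => cases v with
      | some i => exact isEmptyElim i
      | none => rfl
  obtain ⟨y, -, rfl⟩ := hz
  rw [hw]
  simp [lbGW, negWeight, totalWeight, cutValue]

/-- Without free variables, the local bound of a feasible assignment is its objective value. -/
lemma IsLocalBound.eq_obj {p : Partial n} (hp : ∀ i, p i ≠ none) {g : ℝ}
    (hg : IsLocalBound P f M p g) {x : Fin n → Bool} (hx : Extends x p) (hf : P.Feasible x) :
    g = P.obj x := by
  obtain ⟨z, hz, rfl⟩ := hg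
  have : IsEmpty (Free p) := ⟨fun i => hp i.1 i.2⟩
  -- The left side of each reduced constraint is an empty sum.
  have hb : ∀ j, (P.reduce p).b j = 0 := fun j => by
    have := (reduce_rowHolds P hx j).2 (hf j)
    rw [BLP.RowHolds] at this
    simpa using this.symm
  rw [lbGW_cutWeight_of_isEmpty _ hz, ← reduce_obj P hx]
  simp [BLP.const, BLP.transformConst, BLP.obj, hb, Matrix.trace]

lemma ChildRel.lb_le {N N' : Node n} (h : ChildRel P f M N N') : N.lb ≤ N'.lb := by
  obtain ⟨k, v, -, -, -, h⟩ := h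
  rw [h]; exact le_max_right _ _

lemma lb_le_of_path {N N' : Node n} (h : Relation.ReflTransGen (ChildRel P f M) N N') :
    N.lb ≤ N'.lb := by
  induction h with
  | refl => exact le_rfl
  | tail _ hs ih => exact ih.trans hs.lb_le

lemma IsTreeNode.child {N N' : Node n} (hN : IsTreeNode P f M N) (h : ChildRel P f M N N') :
    IsTreeNode P f M N' := by
  obtain ⟨R, hR, hp⟩ := hN
  exact ⟨R, hR, hp.tail h⟩

lemma IsTreeNode.isLocalBound {N : Node n} (hN : IsTreeNode P f M N) :
    IsLocalBound P f M N.fixed N.gw ∧ N.gw ≤ N.lb := by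
  obtain ⟨R, ⟨-, hR, hlb⟩, hp⟩ := hN
  cases hp with
  | refl => exact ⟨hR, hlb.ge⟩
  | tail _ hs =>
    obtain ⟨k, v, -, -, hg, hlb⟩ := hs
    exact ⟨hg, by rw [hlb]; exact le_max_left _ _⟩

/-- Both arguments of the maximum are valid: the node's own bound directly, the inherited one
because `x` also extends the fixed variables of the parent. -/
lemma IsTreeNode.lb_le_obj (hM : 0 ≤ M) {N : Node n} (hN : IsTreeNode P f M N)
    {x : Fin n → Bool} (hx : Extends x N.fixed) (hf : P.Feasible x) : N.lb ≤ P.obj x := by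
  obtain ⟨R, ⟨-, hR, hlb⟩, hp⟩ := hN
  induction hp with
  | refl => rw [hlb]; exact hR.le_obj hM hx hf
  | tail _ hs ih =>
    obtain ⟨k, v, hk, hprop, hg, hlb'⟩ := hs
    rw [hlb']
    exact max_le (hg.le_obj hM hx hf)
      (ih (extends_of_extends_update hk (hprop.extends_of_extends hx)))

/-- The lower bound is squeezed between the local bound, which is exact here, and the objective
value. If `x` violates a row, that row is a contradiction, as `x` is the only extension. -/
lemma IsTreeNode.contradiction_or_lb_eq (hM : 0 ≤ M) {N : Node n} (hN : IsTreeNode P f M N)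
    (hfree : ¬ N.HasFree) {x : Fin n → Bool} (hx : Extends x N.fixed) :
    (Contradiction P N.fixed ∧ ¬ P.Feasible x) ∨ (P.Feasible x ∧ N.lb = P.obj x) := by
  have hp : ∀ i, N.fixed i ≠ none := fun i hi => hfree ⟨i, hi⟩
  by_cases hf : P.Feasible x
  · refine Or.inr ⟨hf, le_antisymm (hN.lb_le_obj hM hx hf) ?_⟩
    rw [← hN.isLocalBound.1.eq_obj hp hx hf]
    exact hN.isLocalBound.2
  · refine Or.inl ⟨?_, hf⟩
    obtain ⟨j, hj⟩ := not_forall.1 hf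
    exact ⟨j, fun y hy => by rwa [hy.eq hp hx]⟩

lemma IsChild.freeCount_lt {N N' : Node n} {k : Fin n} {v : Bool} (h : IsChild P f M N k v N') :
    freeCount N'.fixed + 1 ≤ freeCount N.fixed := by
  have h1 := freeCount_update h.1 v
  have h2 := h.2.1.freeCount_le
  lia

lemma IsChild.extends_of_feasible {N N' : Node n} {k : Fin n} {x : Fin n → Bool}
    (h : IsChild P f M N k (x k) N') (hx : Extends x N.fixed) (hf : P.Feasible x) :
    Extends x N'.fixed :=
  h.2.1.extends_of_feasible (extends_update hx k) hf

variable (P f M) in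
lemma exists_isChild (N : Node n) {k : Fin n} (hk : N.fixed k = none) (v : Bool) :
    ∃ N', IsChild P f M N k v N' := by
  obtain ⟨g, hg⟩ := exists_isLocalBound P f M (Function.update N.fixed k (some v))
  exact ⟨⟨Function.update N.fixed k (some v), g, max g N.lb⟩, hk,
    Relation.ReflTransGen.refl, hg, rfl⟩

variable (P f M) in
lemma exists_isInitial : ∃ s : State n, IsInitial P f M s := by
  obtain ⟨g, hg⟩ := exists_isLocalBound P f M (fun _ => none)
  exact ⟨_, ⟨_, g, g⟩, ⟨rfl, hg, rfl⟩, rfl⟩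

/-- A feasible point in the subproblem would have a value at least the local bound, but below `M`.
-/
lemma ProvenInfeasible.not_feasible (hM : 0 ≤ M) (hbig : ∀ x, P.Feasible x → P.obj x < M)
    {N : Node n} (hN : IsTreeNode P f M N) (h : ProvenInfeasible P M N) {x : Fin n → Bool}
    (hx : Extends x N.fixed) : ¬ P.Feasible x := by
  intro hf
  rcases h with ⟨j, hj⟩ | h
  · exact hj x hx (hf j)
  · exact absurd (hbig x hf) (not_lt.2 (h.trans (hN.isLocalBound.1.le_obj hM hx hf)))

end Tree

/-! ### The incumbent -/

section Incumbent

variable {m n : ℕ} {P : BLP m (Fin n)} {inc inc' : Option (Fin n → Bool)}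
  {X : Multiset (Fin n → Bool)}

lemma IncumbentUpdate.upperBound_le (h : IncumbentUpdate P inc X inc') :
    upperBound P inc' ≤ upperBound P inc := by
  rcases h with ⟨rfl, -⟩ | ⟨x, -, -, hlt, -, rfl⟩
  · exact le_rfl
  · exact hlt.le

lemma IncumbentUpdate.upperBound_le_obj (h : IncumbentUpdate P inc X inc') {x : Fin n → Bool}
    (hx : x ∈ X) (hf : P.Feasible x) : upperBound P inc' ≤ (P.obj x : EReal) := by
  rcases h with ⟨rfl, h⟩ | ⟨y, -, -, -, h, rfl⟩
  · exact h x hx hf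
  · exact EReal.coe_le_coe_iff.2 (h x hx hf)

lemma IncumbentUpdate.eq_or (h : IncumbentUpdate P inc X inc') :
    inc' = inc ∨ ∃ x ∈ X, P.Feasible x ∧ inc' = some x := by
  rcases h with ⟨h, -⟩ | ⟨x, hx, hf, -, -, h⟩
  · exact Or.inl h
  · exact Or.inr ⟨x, hx, hf, h⟩

lemma IncumbentUpdate.feasible (h : IncumbentUpdate P inc X inc')
    (hinc : ∀ x, inc = some x → P.Feasible x) (x : Fin n → Bool) (hx : inc' = some x) :
    P.Feasible x := by
  rcases h.eq_or with rfl | ⟨y, -, hy, rfl⟩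
  · exact hinc x hx
  · exact Option.some.inj hx ▸ hy

variable (P inc X) in
lemma exists_incumbentUpdate : ∃ inc', IncumbentUpdate P inc X inc' := by
  classical
  by_cases h : ∀ x ∈ X, P.Feasible x → upperBound P inc ≤ (P.obj x : EReal)
  · exact ⟨inc, Or.inl ⟨rfl, h⟩⟩
  · push Not at h
    obtain ⟨x, hx, hf, hlt⟩ := h
    obtain ⟨y, hy, hmin⟩ := (X.toFinset.filter P.Feasible).exists_min_image P.obj
      ⟨x, by simp [hx, hf]⟩
    simp only [Finset.mem_filter, Multiset.mem_toFinset] at hy hmin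
    exact ⟨some y, Or.inr ⟨y, hy.1, hy.2,
      (EReal.coe_le_coe_iff.2 (hmin x ⟨hx, hf⟩)).trans_lt hlt, fun u hu hfu => hmin u ⟨hu, hfu⟩,
      rfl⟩⟩

end Incumbent

/-! ### The search -/

section Search

variable {m n : ℕ} {P : BLP m (Fin n)} {f : IsingForm} {M : ℝ} {X : Samples n}

/-- The invariant of the search. The open nodes are weighted with the largest possible number of
nodes in their subtrees. -/
structure SearchInvariant (P : BLP m (Fin n)) (f : IsingForm) (M : ℝ) (s : State n) : Prop where
  treeNode : ∀ N, N ∈ s.frontier ∨ N ∈ s.processed → IsTreeNode P f M N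
  feasible : ∀ x, s.incumbent = some x → P.Feasible x
  cover : ∀ x, P.Feasible x → upperBound P s.incumbent ≤ (P.obj x : EReal) ∨
    ∃ N ∈ s.frontier, Extends x N.fixed
  -- A binary tree of depth `d` has at most `2 ^ d - 1` inner nodes and `2 ^ (d + 1) - 1` nodes.
  -- Every child has fewer free variables than its parent, so `freeCount` bounds the depth below a
  -- node.
  countP_add_le : s.processed.countP (fun N => decide N.HasFree) +
    (s.frontier.map fun N => 2 ^ freeCount N.fixed - 1).sum ≤ 2 ^ n - 1
  length_add_le : s.processed.length +
    (s.frontier.map fun N => 2 ^ (freeCount N.fixed + 1) - 1).sum ≤ 2 ^ (n + 1) - 1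

lemma SearchInvariant.initial {s : State n} (h : IsInitial P f M s) : SearchInvariant P f M s := by
  obtain ⟨R, hR, rfl⟩ := h
  have hc : freeCount R.fixed = n := by rw [hR.1]; simp [freeCount]
  refine ⟨?_, by simp, fun x _ => Or.inr ⟨R, by simp, ?_⟩, by simp [hc], by simp [hc]⟩
  · intro N hN
    simp only [Multiset.mem_singleton, List.not_mem_nil, or_false] at hN
    subst hN
    exact ⟨N, hR, Relation.ReflTransGen.refl⟩
  · rw [hR.1]; intro i v h; simp at h

/-- Removing an open node `N` from the frontier keeps the invariant, if every feasible point of its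
subproblem is dominated by the new incumbent. -/
lemma SearchInvariant.close {N : Node n} {F : Multiset (Node n)} {inc inc' : Option (Fin n → Bool)}
    {done : List (Node n)} (h : SearchInvariant P f M ⟨N ::ₘ F, inc, done⟩)
    (hfeas : ∀ x, inc' = some x → P.Feasible x) (hle : upperBound P inc' ≤ upperBound P inc)
    (hN : ∀ x, P.Feasible x → Extends x N.fixed → upperBound P inc' ≤ (P.obj x : EReal)) :
    SearchInvariant P f M ⟨F, inc', N :: done⟩ := by
  obtain ⟨h1, -, h3, h4, h5⟩ := h
  refine ⟨?_, hfeas, ?_, ?_, ?_⟩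
  · intro N' hN'
    apply h1
    simp only [List.mem_cons, Multiset.mem_cons] at hN' ⊢
    tauto
  · intro x hx
    rcases h3 x hx with h | ⟨N', hN', hext⟩
    · exact Or.inl (hle.trans h)
    · rcases Multiset.mem_cons.1 hN' with rfl | hN'
      · exact Or.inl (hN x hx hext)
      · exact Or.inr ⟨N', hN', hext⟩
  · simp only [Multiset.map_cons, Multiset.sum_cons, List.countP_cons] at h4 ⊢
    -- A node with a free variable has weight at least 1, which pays for counting it; the others
    -- have weight 0 and are not counted here.
    by_cases hf : N.HasFree
    · have := Nat.one_lt_two_pow (freeCount_pos hf).ne'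
      simp only [hf, decide_true, if_true]
      lia
    · simp only [hf, decide_false, Bool.false_eq_true, if_false]
      lia
  · simp only [Multiset.map_cons, Multiset.sum_cons, List.length_cons] at h5 ⊢
    have := Nat.one_lt_two_pow (Nat.succ_ne_zero (freeCount N.fixed))
    lia

lemma SearchInvariant.branch {N N₀ N₁ : Node n} {F : Multiset (Node n)}
    {inc inc' : Option (Fin n → Bool)} {done : List (Node n)} {k : Fin n}
    (h : SearchInvariant P f M ⟨N ::ₘ F, inc, done⟩)
    (hfeas : ∀ x, inc' = some x → P.Feasible x) (hle : upperBound P inc' ≤ upperBound P inc)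
    (h₀ : IsChild P f M N k false N₀) (h₁ : IsChild P f M N k true N₁) :
    SearchInvariant P f M ⟨N₀ ::ₘ N₁ ::ₘ F, inc', N :: done⟩ := by
  obtain ⟨h1, -, h3, h4, h5⟩ := h
  have hN : IsTreeNode P f M N := h1 N (by simp)
  have c0 := h₀.freeCount_lt
  have c1 := h₁.freeCount_lt
  -- With at most `d` free variables in each child, `1 + (2 ^ d - 1) + (2 ^ d - 1) = 2 ^ (d + 1) -
  -- 1` balances the count. The lower bounds by 1 that follow control the truncated subtraction.
  obtain ⟨d, hd⟩ : ∃ d, freeCount N.fixed = d + 1 := ⟨freeCount N.fixed - 1, by lia⟩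
  have p0 := Nat.pow_le_pow_right two_pos (show freeCount N₀.fixed ≤ d by lia)
  have p1 := Nat.pow_le_pow_right two_pos (show freeCount N₁.fixed ≤ d by lia)
  have pd := Nat.one_le_two_pow (n := d)
  have q0 := Nat.one_le_two_pow (n := freeCount N₀.fixed)
  have q1 := Nat.one_le_two_pow (n := freeCount N₁.fixed)
  refine ⟨?_, hfeas, ?_, ?_, ?_⟩
  · intro N' hN'
    simp only [List.mem_cons, Multiset.mem_cons] at hN'
    rcases hN' with (rfl | rfl | hN') | rfl | hN'
    · exact hN.child ⟨k, false, h₀⟩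
    · exact hN.child ⟨k, true, h₁⟩
    · exact h1 N' (by simp [hN'])
    · exact hN
    · exact h1 N' (by simp [hN'])
  · intro x hx
    rcases h3 x hx with h | ⟨N', hN', hext⟩
    · exact Or.inl (hle.trans h)
    · right
      rcases Multiset.mem_cons.1 hN' with rfl | hN'
      · cases hxk : x k with
        | false => exact ⟨N₀, by simp, IsChild.extends_of_feasible (hxk ▸ h₀) hext hx⟩
        | true => exact ⟨N₁, by simp, IsChild.extends_of_feasible (hxk ▸ h₁) hext hx⟩
      · exact ⟨N', by simp [hN'], hext⟩
  · have hf : N.HasFree := ⟨k, h₀.1⟩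
    simp only [Multiset.map_cons, Multiset.sum_cons, List.countP_cons, hf, decide_true, if_true,
      hd, pow_succ] at h4 ⊢
    lia
  · simp only [Multiset.map_cons, Multiset.sum_cons, List.length_cons, hd, pow_succ] at h5 ⊢
    lia

/-- A discarded node has no feasible point, or a single assignment that has been offered to the
incumbent, or a lower bound above the incumbent value. Branching keeps each feasible point in the
child that has its value of `x k`. -/
lemma SearchInvariant.step (hM : 0 ≤ M) (hbig : ∀ x, P.Feasible x → P.obj x < M) {s s' : State n}
    (h : SearchInvariant P f M s) (hs : Step P f M X s s') : SearchInvariant P f M s' := by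
  cases hs with
  | infeasible N F inc done hsel hinf =>
    have hN : IsTreeNode P f M N := h.treeNode N (by simp)
    exact h.close h.feasible le_rfl fun x hx hext => absurd hx (hinf.not_feasible hM hbig hN hext)
  | leaf N F inc inc' done x hsel hinf hleaf hx hupd =>
    refine h.close (hupd.feasible h.feasible) hupd.upperBound_le fun y hy hext => ?_
    have : y = x := hext.eq (fun i hi => hleaf ⟨i, hi⟩) hx
    subst this
    exact hupd.upperBound_le_obj (by simp) hy
  | prune N F inc inc' done hsel hinf hfree hupd hprune =>
    have hN : IsTreeNode P f M N := h.treeNode N (by simp)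
    exact h.close (hupd.feasible h.feasible) hupd.upperBound_le fun y hy hext =>
      hprune.le.trans (EReal.coe_le_coe_iff.2 (hN.lb_le_obj hM hext hy))
  | branch N N₀ N₁ F inc inc' done k hsel hinf hupd hkeep hk h₀ h₁ =>
    exact h.branch (hupd.feasible h.feasible) hupd.upperBound_le h₀ h₁

lemma Reachable.searchInvariant (hM : 0 ≤ M) (hbig : ∀ x, P.Feasible x → P.obj x < M)
    {s : State n} (h : Reachable P f M X s) : SearchInvariant P f M s := by
  obtain ⟨s₀, h₀, hp⟩ := h
  induction hp with
  | refl => exact SearchInvariant.initial h₀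
  | tail _ hs ih => exact ih.step hM hbig hs

lemma Step.upperBound_le {s s' : State n} (hs : Step P f M X s s') :
    upperBound P s'.incumbent ≤ upperBound P s.incumbent := by
  cases hs with
  | infeasible => exact le_rfl
  | leaf _ _ _ _ _ _ _ _ _ _ hupd => exact hupd.upperBound_le
  | prune _ _ _ _ _ _ _ _ hupd => exact hupd.upperBound_le
  | branch _ _ _ _ _ _ _ _ _ _ hupd => exact hupd.upperBound_le

/-- The global lower bound does not decrease if a node of the frontier is replaced by nodes whose
lower bounds are not smaller, and the incumbent by a point of the subproblem of that node. -/
lemma globalLB_le (hM : 0 ≤ M) {N : Node n} (hN : IsTreeNode P f M N)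
    {F F' : Multiset (Node n)} {Y : Multiset (Fin n → Bool)}
    {inc inc' : Option (Fin n → Bool)} {done done' : List (Node n)}
    (hF : ∀ N' ∈ F', N' ∈ F ∨ N.lb ≤ N'.lb) (hupd : IncumbentUpdate P inc Y inc')
    (hY : ∀ x ∈ Y, Extends x N.fixed) :
    globalLB P ⟨N ::ₘ F, inc, done⟩ ≤ globalLB P ⟨F', inc', done'⟩ := by
  have hmem : ∀ N' ∈ N ::ₘ F, globalLB P ⟨N ::ₘ F, inc, done⟩ ≤ (N'.lb : EReal) := fun N' hN' =>
    (min_le_right _ _).trans (iInf₂_le N' hN')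
  refine le_min ?_ (le_iInf₂ fun N' hN' => ?_)
  · rcases hupd.eq_or with rfl | ⟨x, hx, hf, rfl⟩
    · exact min_le_left _ _
    · exact (hmem N (by simp)).trans (EReal.coe_le_coe_iff.2 (hN.lb_le_obj hM (hY x hx) hf))
  · rcases hF N' hN' with h | h
    · exact hmem N' (by simp [h])
    · exact (hmem N (by simp)).trans (EReal.coe_le_coe_iff.2 h)

lemma Step.globalLB_le (hM : 0 ≤ M) {s s' : State n} (h : SearchInvariant P f M s)
    (hs : Step P f M X s s') : globalLB P s ≤ globalLB P s' := by
  cases hs with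
  | infeasible N F inc done hsel hinf =>
    -- Discarding an infeasible node counts as an update without samples.
    exact QCBB.globalLB_le (Y := 0) hM (h.treeNode N (by simp)) (fun _ h => Or.inl h)
      (Or.inl ⟨rfl, by simp⟩) (by simp)
  | leaf N F inc inc' done x hsel hinf hleaf hx hupd =>
    exact QCBB.globalLB_le hM (h.treeNode N (by simp)) (fun _ h => Or.inl h) hupd (by simpa using hx)
  | prune N F inc inc' done hsel hinf hfree hupd hprune =>
    refine QCBB.globalLB_le hM (h.treeNode N (by simp)) (fun _ h => Or.inl h) hupd fun x hx => ?_
    obtain ⟨y, -, rfl⟩ := Multiset.mem_map.1 hx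
    exact extends_complete _ _
  | branch N N₀ N₁ F inc inc' done k hsel hinf hupd hkeep hk h₀ h₁ =>
    refine QCBB.globalLB_le hM (h.treeNode N (by simp)) (fun N' hN' => ?_) hupd fun x hx => ?_
    · simp only [Multiset.mem_cons] at hN'
      rcases hN' with rfl | rfl | hN'
      · exact Or.inr (ChildRel.lb_le ⟨k, false, h₀⟩)
      · exact Or.inr (ChildRel.lb_le ⟨k, true, h₁⟩)
      · exact Or.inl hN'
    · obtain ⟨y, -, rfl⟩ := Multiset.mem_map.1 hx
      exact extends_complete _ _

lemma SearchInvariant.globalLB_le_optValue (hM : 0 ≤ M) {s : State n}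
    (h : SearchInvariant P f M s) : globalLB P s ≤ P.optValue := by
  refine le_iInf fun ⟨x, hx⟩ => ?_
  rcases h.cover x hx with hle | ⟨N, hN, hext⟩
  · exact (min_le_left _ _).trans hle
  · exact ((min_le_right _ _).trans (iInf₂_le N hN)).trans
      (EReal.coe_le_coe_iff.2 ((h.treeNode N (Or.inl hN)).lb_le_obj hM hext hx))

lemma SearchInvariant.optValue_le_upperBound {s : State n} (h : SearchInvariant P f M s) :
    P.optValue ≤ upperBound P s.incumbent := by
  cases hinc : s.incumbent with
  | none => exact le_top
  | some x => exact iInf_le (fun x : {x // P.Feasible x} => (P.obj x : EReal)) ⟨x, h.feasible x hinc⟩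

/-- The stopping criterion makes the incumbent attain the minimum in `globalLB`, so the two bounds
that enclose the optimal value coincide. Without an incumbent this value is `⊤`, which excludes
feasible points. -/
lemma SearchInvariant.result (hM : 0 ≤ M) {s : State n} (h : SearchInvariant P f M s)
    (ht : Terminated P s) :
    globalLB P s = P.optValue ∧ upperBound P s.incumbent = P.optValue ∧
      ((s.incumbent = none ∧ ∀ x, ¬ P.Feasible x) ∨
        ∃ x, s.incumbent = some x ∧ P.IsOptimal x) := by
  have h1 : upperBound P s.incumbent ≤ globalLB P s := le_min le_rfl (le_iInf₂ ht)
  have h2 := h.globalLB_le_optValue hM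
  have h3 := h.optValue_le_upperBound
  have h4 : upperBound P s.incumbent = P.optValue := le_antisymm (h1.trans h2) h3
  refine ⟨le_antisymm h2 (h3.trans h1), h4, ?_⟩
  have h5 : ∀ x, P.Feasible x → upperBound P s.incumbent ≤ (P.obj x : EReal) := fun x hx =>
    h4.le.trans (iInf_le (fun x : {x // P.Feasible x} => (P.obj x : EReal)) ⟨x, hx⟩)
  cases hinc : s.incumbent with
  | none =>
    refine Or.inl ⟨rfl, fun x hx => ?_⟩
    have := h5 x hx
    rw [hinc] at this
    exact absurd this (not_le.2 (EReal.coe_lt_top _))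
  | some x =>
    refine Or.inr ⟨x, rfl, h.feasible x hinc, fun y hy => ?_⟩
    have := h5 y hy
    rw [hinc] at this
    exact EReal.coe_le_coe_iff.1 this

-- The tests of a step are exhaustive, and each object that it requires exists: an open node of
-- lowest bound, an update of the incumbent, a free variable of maximal conflict value, and the
-- children, here without propagation.
variable (P f M X) in
lemma exists_step {s : State n} (hs : s.frontier ≠ 0) : ∃ s', Step P f M X s s' := by
  classical
  obtain ⟨F₀, inc, done⟩ := s
  obtain ⟨N₀, hN₀⟩ := Multiset.exists_mem_of_ne_zero hs
  obtain ⟨N, hN, hmin⟩ := F₀.toFinset.exists_min_image Node.lb ⟨N₀, by simpa using hN₀⟩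
  obtain ⟨F, rfl⟩ := Multiset.exists_cons_of_mem (Multiset.mem_toFinset.1 hN)
  have hsel : ∀ N' ∈ F, N.lb ≤ N'.lb := fun N' hN' => hmin N' (by simp [hN'])
  by_cases hinf : ProvenInfeasible P M N
  · exact ⟨_, Step.infeasible N F inc done hsel hinf⟩
  by_cases hfree : N.HasFree
  · obtain ⟨inc', hupd⟩ := exists_incumbentUpdate P inc
      ((X done.length N.fixed).map (complete N.fixed))
    rcases lt_or_ge (upperBound P inc') (N.lb : EReal) with hlt | hge
    · exact ⟨_, Step.prune N F inc inc' done hsel hinf hfree hupd hlt⟩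
    · obtain ⟨i, hi⟩ := hfree
      have : Nonempty (Free N.fixed) := ⟨⟨i, hi⟩⟩
      obtain ⟨k, hk⟩ := Finite.exists_max
        ((P.reduce N.fixed).conflict (X done.length N.fixed))
      obtain ⟨N₀, h₀⟩ := exists_isChild P f M N k.2 false
      obtain ⟨N₁, h₁⟩ := exists_isChild P f M N k.2 true
      exact ⟨_, Step.branch N N₀ N₁ F inc inc' done k hsel hinf hupd hge hk h₀ h₁⟩
  · obtain ⟨x, hx⟩ := exists_extends N.fixed
    obtain ⟨inc', hupd⟩ := exists_incumbentUpdate P inc {x}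
    exact ⟨_, Step.leaf N F inc inc' done x hsel hinf hfree hx hupd⟩

lemma Step.length_processed {s s' : State n} (hs : Step P f M X s s') :
    s'.processed.length = s.processed.length + 1 := by
  cases hs <;> rfl

/-- Each step processes one node, so `2 ^ (n + 1)` steps would exceed the bound on all processed
nodes. -/
lemma no_infinite_execution (hM : 0 ≤ M) (hbig : ∀ x, P.Feasible x → P.obj x < M)
    (s : ℕ → State n) (h0 : IsInitial P f M (s 0)) :
    ¬ ∀ t, Step P f M X (s t) (s (t + 1)) := by
  intro hs
  have hinv : ∀ t, SearchInvariant P f M (s t) := fun t => by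
    induction t with
    | zero => exact SearchInvariant.initial h0
    | succ t ih => exact ih.step hM hbig (hs t)
  have hlen : ∀ t, t ≤ (s t).processed.length := fun t => by
    induction t with
    | zero => exact Nat.zero_le _
    | succ t ih => rw [(hs t).length_processed]; lia
  have h1 := (hinv (2 ^ (n + 1))).length_add_le
  have h2 := hlen (2 ^ (n + 1))
  have h3 := Nat.one_le_two_pow (n := n + 1)
  lia

end Search

end QCBB

/-! ### Correctness and finiteness of the branch and bound search. -/

theorem mainTheorem4 {m n : ℕ} (A : Matrix (Fin m) (Fin n) ℝ) (b : Fin m → ℝ) (c : Fin n → ℝ)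
    (f : QCBB.IsingForm) (X : QCBB.Samples n) (M : ℝ) (hM : 0 ≤ M)
    (hbig : ∀ x, (QCBB.master A b c).Feasible x → (QCBB.master A b c).obj x < M) :
    -- lower bounds are monotone along tree paths
    (∀ N N', QCBB.IsTreeNode (QCBB.master A b c) f M N →
      Relation.ReflTransGen (QCBB.ChildRel (QCBB.master A b c) f M) N N' → N.lb ≤ N'.lb) ∧
    -- the bound of a node is a lower bound for its subproblem
    (∀ N x, QCBB.IsTreeNode (QCBB.master A b c) f M N → QCBB.Extends x N.fixed →
      (QCBB.master A b c).Feasible x → N.lb ≤ (QCBB.master A b c).obj x) ∧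
    -- at a node without free variables, the subproblem is proven infeasible or the bounds meet
    (∀ N x, QCBB.IsTreeNode (QCBB.master A b c) f M N → ¬ N.HasFree → QCBB.Extends x N.fixed →
      (QCBB.Contradiction (QCBB.master A b c) N.fixed ∧ ¬ (QCBB.master A b c).Feasible x) ∨
      ((QCBB.master A b c).Feasible x ∧ N.lb = (QCBB.master A b c).obj x)) ∧
    -- an execution can be started
    (∃ s, QCBB.IsInitial (QCBB.master A b c) f M s) ∧
    -- the global bounds move monotonically
    (∀ s s', QCBB.Reachable (QCBB.master A b c) f M X s → QCBB.Step (QCBB.master A b c) f M X s s' →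
      QCBB.globalLB (QCBB.master A b c) s ≤ QCBB.globalLB (QCBB.master A b c) s' ∧
      QCBB.upperBound (QCBB.master A b c) s'.incumbent
        ≤ QCBB.upperBound (QCBB.master A b c) s.incumbent) ∧
    (∀ s, QCBB.Reachable (QCBB.master A b c) f M X s →
      -- all nodes of the search are tree nodes
      (∀ N, N ∈ s.frontier ∨ N ∈ s.processed → QCBB.IsTreeNode (QCBB.master A b c) f M N) ∧
      -- the global bounds enclose the optimal value
      QCBB.globalLB (QCBB.master A b c) s ≤ (QCBB.master A b c).optValue ∧
      (QCBB.master A b c).optValue ≤ QCBB.upperBound (QCBB.master A b c) s.incumbent ∧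
      -- discarding nodes loses no improving solution
      (∀ x, (QCBB.master A b c).Feasible x →
        QCBB.upperBound (QCBB.master A b c) s.incumbent
            ≤ (((QCBB.master A b c).obj x : ℝ) : EReal) ∨
          ∃ N ∈ s.frontier, QCBB.Extends x N.fixed) ∧
      -- number of processed nodes that have free variables, and of all processed nodes
      s.processed.countP (fun N => decide N.HasFree) ≤ 2 ^ n - 1 ∧
      s.processed.length ≤ 2 ^ (n + 1) - 1 ∧
      -- the search never gets stuck before the stopping criterion holds
      (¬ QCBB.Terminated (QCBB.master A b c) s →
        ∃ s', QCBB.Step (QCBB.master A b c) f M X s s') ∧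
      -- result of the search
      (QCBB.Terminated (QCBB.master A b c) s →
        QCBB.globalLB (QCBB.master A b c) s = (QCBB.master A b c).optValue ∧
        QCBB.upperBound (QCBB.master A b c) s.incumbent = (QCBB.master A b c).optValue ∧
        ((s.incumbent = none ∧ ∀ x, ¬ (QCBB.master A b c).Feasible x) ∨
          ∃ x, s.incumbent = some x ∧ (QCBB.master A b c).IsOptimal x))) ∧
    -- there is no infinite execution
    (∀ s : ℕ → QCBB.State n, QCBB.IsInitial (QCBB.master A b c) f M (s 0) →
      ¬ ∀ t, QCBB.Step (QCBB.master A b c) f M X (s t) (s (t + 1))) := by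
  refine ⟨fun N N' _ h => QCBB.lb_le_of_path h, fun N x hN hx hf => hN.lb_le_obj hM hx hf,
    fun N x hN hfree hx => hN.contradiction_or_lb_eq hM hfree hx,
    QCBB.exists_isInitial _ f M,
    fun s s' hr hs => ⟨hs.globalLB_le hM (hr.searchInvariant hM hbig), hs.upperBound_le⟩,
    fun s hr => ?_, fun s h0 => QCBB.no_infinite_execution hM hbig s h0⟩
  have h := hr.searchInvariant hM hbig
  refine ⟨h.treeNode, h.globalLB_le_optValue hM, h.optValue_le_upperBound, h.cover,
    le_trans (Nat.le_add_right _ _) h.countP_add_le,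
    le_trans (Nat.le_add_right _ _) h.length_add_le, fun ht => ?_, h.result hM⟩
  -- An empty frontier satisfies the stopping criterion vacuously.
  refine QCBB.exists_step _ f M X fun h0 => ht fun N hN => ?_
  rw [h0] at hN
  exact absurd hN (Multiset.notMem_zero N)
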